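/- Let $(\Omega,\mathcal F,(\mathcal F_t)_{t\ge 0},\mathbb P)$ be a filtered probability space satisfying the usual conditions. Let $\xi=(\xi(t))_{t\ge0}$ and $\eta=(\eta(t))_{t\ge0}$ be two nonnegative measurable $\mathcal F_t$-adapted real processes such that $t\mapsto\xi(t)$ is càdlàg, let $A=(A_t)_{t\ge 0}$ be a continuous nondecreasing $\mathcal F_t$-adapted process with $A_0=0$, and let $M=(M_t)_{t\ge0}$ be a càdlàg (not necessarily continuous) local martingale with $M_0=0$. Suppose that, almost surely, $$\xi(t)\le \xi(0)+\int_0^t\eta(s)\,\mathrm ds+\int_0^t\xi(s)\,\mathrm dA_s+M_t\qquad\text{for every } t\ge 0,$$ where the integrals take values in $[0,\infty]$ and $\mathrm dA_s$ is the Lebesgue–Stieltjes measure of the path of $A$. Then for all $0<q<p<1$ and all $t\ge 0$, $$\Big[\mathbb E\Big(\sup_{s\in[0,t]}\xi(s)\Big)^{q}\Big]^{1/q}\le\Big(\frac{p}{p-q}\Big)^{1/q}\Big(\mathbb E\,\mathrm e^{pA_t/(1-p)}\Big)^{(1-p)/p}\;\mathbb E\Big(\xi(0)+\int_0^t\eta(s)\,\mathrm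 ds\Big),$$ as an inequality in $[0,\infty]$, with the convention $\infty\cdot 0=0$. -/

import Mathlib

open MeasureTheory ProbabilityTheory Filter Set
open scoped NNReal ENNReal Topology

namespace StochGronwall

/-- The usual conditions: the filtration is right-continuous, and `𝓕 0` contains every subset of a
`P`-null set (so that `P` is complete). -/
structure UsualConditions {Ω : Type*} {mΩ : MeasurableSpace Ω} (𝓕 : Filtration ℝ≥0 mΩ)
    (P : Measure Ω) : Prop where
  rightContinuous : 𝓕.IsRightContinuous
  complete : ∀ s : Set Ω, P s = 0 → MeasurableSet[𝓕 0] s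

/-- A path is càdlàg: right-continuous with (finite) left limits at every time. -/
def IsCadlag (x : ℝ≥0 → ℝ) : Prop :=
  (∀ t, ContinuousWithinAt x (Ici t) t) ∧ ∀ t, ∃ l : ℝ, Tendsto x (𝓝[<] t) (𝓝 l)

/-- A (càdlàg, not necessarily continuous) local martingale. `Locally` asks for stopping times
`τ n` which a.s. increase to infinity such that every process
`t ↦ 1_{τ n > 0} X (min t (τ n))` is a martingale. -/
structure IsLocalMartingale {Ω : Type*} {mΩ : MeasurableSpace Ω} (X : ℝ≥0 → Ω → ℝ)
    (𝓕 : Filtration ℝ≥0 mΩ) (P : Measure Ω) : Prop where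
  adapted : StronglyAdapted 𝓕 X
  cadlag : ∀ᵐ ω ∂P, IsCadlag (fun t => X t ω)
  locally_martingale : Locally (fun Y : ℝ≥0 → Ω → ℝ => Martingale Y 𝓕 P) 𝓕 X P

open Classical in
/-- The Lebesgue–Stieltjes measure `da` on `[0, ∞)` of a nondecreasing path `a`, without mass at
`0`. For paths that are not nondecreasing (a null set of paths in what follows) it is `0`. -/
noncomputable def pathMeasure (a : ℝ≥0 → ℝ) : Measure ℝ≥0 :=
  if h : Monotone a then h.stieltjesFunction.measure else 0

end StochGronwall

/-!
Discounting by `e^{-A}` removes the Gronwall term: integrating by parts against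
`d(e^{-A}) = -e^{-A} dA`, the hypothesis becomes
`ξ s * e^{-A_s} ≤ H + ∫_{(0, s]} e^{-A} dM` with `H = ξ 0 + ∫₀ᵗ η`, and the right-hand side is
nonnegative. After stopping `M` the integral is a martingale, since it is the `L¹` limit of discrete
integrals along uniform grids; here the integrator is the càdlàg `M` and `e^{-A}` is continuous, so
that by parts only the path measure `dA` is needed and stochastic integration is avoided. Doob's
maximal argument, run with the weight `e^{-A_t}`, gives
`x * E[e^{-A_t}; sup ξ > x] ≤ E H`. Hölder's inequality turns this into
`x ^ p * P(sup ξ > x) ≤ (E e^{p A_t / (1 - p)}) ^ (1 - p) * (E H) ^ p`, and integrating the tail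
against `q x ^ (q - 1)` produces the moment of order `q` with the constant `p / (p - q)`. The
supremum is reached along grids and localizing times by Fatou's lemma.
-/

namespace StochGronwall

/-! ### Uniform grids and càdlàg paths -/

section Grid

variable {x y u : ℝ≥0} {n i : ℕ}

/-- The `i`-th point of the partition of `[x, y]` into `n + 1` intervals of equal length. -/
noncomputable def gridPoint (x y : ℝ≥0) (n i : ℕ) : ℝ≥0 := x + i * ((y - x) / (n + 1))

/-- The right end of the cell `(gridPoint x y n i, gridPoint x y n (i + 1)]` containing `u`. -/
noncomputable def gridCeil (x y : ℝ≥0) (n : ℕ) (u : ℝ≥0) : ℝ≥0 :=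
  gridPoint x y n ⌈(u - x) / ((y - x) / (n + 1))⌉₊

lemma gridPoint_zero (x y : ℝ≥0) (n : ℕ) : gridPoint x y n 0 = x := by simp [gridPoint]

lemma gridPoint_last (hxy : x ≤ y) (n : ℕ) : gridPoint x y n (n + 1) = y := by
  rw [gridPoint, Nat.cast_succ, mul_div_cancel₀ _ (by positivity), add_tsub_cancel_of_le hxy]

lemma monotone_gridPoint (x y : ℝ≥0) (n : ℕ) : Monotone (gridPoint x y n) := by
  intro i j hij
  unfold gridPoint
  gcongr

lemma gridPoint_mem_Icc (hxy : x ≤ y) (hi : i ≤ n + 1) : gridPoint x y n i ∈ Icc x y :=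
  ⟨by simp [gridPoint], (monotone_gridPoint x y n hi).trans_eq (gridPoint_last hxy n)⟩

lemma biUnion_Ioc_gridPoint (hxy : x ≤ y) (n : ℕ) :
    ⋃ i ∈ Finset.range (n + 1), Ioc (gridPoint x y n i) (gridPoint x y n (i + 1)) = Ioc x y := by
  have h := (monotone_gridPoint x y n).biUnion_Ico_Ioc_map_succ 0 (n + 1)
  rw [gridPoint_zero, gridPoint_last hxy] at h
  simpa using h

lemma Ioc_gridPoint_subset (hxy : x ≤ y) (hi : i < n + 1) :
    Ioc (gridPoint x y n i) (gridPoint x y n (i + 1)) ⊆ Ioc x y :=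
  Ioc_subset_Ioc (gridPoint_mem_Icc hxy hi.le).1 (gridPoint_mem_Icc hxy hi).2

lemma mesh_pos (hu : u ∈ Ioc x y) (n : ℕ) : 0 < (y - x) / ((n : ℝ≥0) + 1) :=
  div_pos (tsub_pos_of_lt (hu.1.trans_le hu.2)) (by positivity)

lemma le_gridCeil (hu : u ∈ Ioc x y) (n : ℕ) : u ≤ gridCeil x y n u := by
  rw [gridCeil, gridPoint, ← tsub_le_iff_left, ← div_le_iff₀ (mesh_pos hu n)]
  exact Nat.le_ceil _

lemma gridCeil_le_add_mesh (hu : u ∈ Ioc x y) (n : ℕ) :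
    gridCeil x y n u ≤ u + (y - x) / (n + 1) := by
  have hmesh := mesh_pos hu n
  calc gridCeil x y n u
      ≤ x + ((u - x) / ((y - x) / (n + 1)) + 1) * ((y - x) / (n + 1)) := by
        rw [gridCeil, gridPoint]
        gcongr
        exact (Nat.ceil_lt_add_one zero_le).le
    _ = u + (y - x) / (n + 1) := by
        rw [add_one_mul, div_mul_cancel₀ _ hmesh.ne', ← add_assoc, add_tsub_cancel_of_le hu.1.le]

lemma exists_gridCeil_eq_gridPoint (hu : u ∈ Ioc x y) (n : ℕ) :
    ∃ i ≤ n + 1, gridCeil x y n u = gridPoint x y n i := by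
  refine ⟨_, Nat.ceil_le.2 ?_, rfl⟩
  rw [div_le_iff₀ (mesh_pos hu n), Nat.cast_succ, mul_div_cancel₀ _ (by positivity)]
  exact tsub_le_tsub_right hu.2 x

lemma gridCeil_le (hu : u ∈ Ioc x y) (n : ℕ) : gridCeil x y n u ≤ y := by
  obtain ⟨i, hi, h⟩ := exists_gridCeil_eq_gridPoint hu n
  exact h ▸ (gridPoint_mem_Icc (hu.1.le.trans hu.2) hi).2

lemma gridCeil_eq (hu : u ∈ Ioc (gridPoint x y n i) (gridPoint x y n (i + 1))) :
    gridCeil x y n u = gridPoint x y n (i + 1) := by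
  obtain ⟨hlo, hhi⟩ := hu
  unfold gridPoint at hlo hhi
  have hmesh : 0 < (y - x) / ((n : ℝ≥0) + 1) := by
    by_contra! h
    simp only [nonpos_iff_eq_zero.1 h, mul_zero, add_zero] at hlo hhi
    exact hhi.not_gt hlo
  rw [gridCeil, (Nat.ceil_eq_iff i.succ_ne_zero).2
    ⟨(lt_div_iff₀ hmesh).2 (lt_tsub_iff_left.2 hlo),
      (div_le_iff₀ hmesh).2 (tsub_le_iff_left.2 hhi)⟩]

lemma tendsto_gridCeil (hu : u ∈ Ioc x y) :
    Tendsto (fun n => gridCeil x y n u) atTop (𝓝[≥] u) := by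
  have hmesh : Tendsto (fun n : ℕ => (y - x) / ((n : ℝ≥0) + 1)) atTop (𝓝 0) :=
    (tendsto_const_div_atTop_nhds_zero_nat (y - x)).comp (tendsto_add_atTop_nat 1) |>.congr
      fun n => by simp
  refine tendsto_nhdsWithin_iff.2 ⟨?_, Eventually.of_forall (le_gridCeil hu)⟩
  exact tendsto_of_tendsto_of_tendsto_of_le_of_le tendsto_const_nhds
    (by simpa using tendsto_const_nhds.add hmesh) (le_gridCeil hu) (gridCeil_le_add_mesh hu)

end Grid

section Cadlag

variable {f g : ℝ≥0 → ℝ} {x y : ℝ≥0}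

lemma IsCadlag.exists_abs_le (hf : IsCadlag f) (x y : ℝ≥0) : ∃ C, ∀ u ∈ Icc x y, |f u| ≤ C := by
  refine isCompact_Icc.induction_on (p := fun s => ∃ C, ∀ u ∈ s, |f u| ≤ C) ⟨0, by simp⟩
    (fun s s' h ⟨C, hC⟩ => ⟨C, fun u hu => hC u (h hu)⟩) ?_ fun u _ => ?_
  · rintro s s' ⟨C, hC⟩ ⟨D, hD⟩
    exact ⟨max C D, fun u hu => le_max_iff.2 (hu.imp (hC u) (hD u))⟩
  · obtain ⟨l, hl⟩ := hf.2 u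
    have hleft : ∀ᶠ v in 𝓝[<] u, |f v| < |l| + 1 := hl.abs.eventually_lt_const (lt_add_one _)
    have hright : ∀ᶠ v in 𝓝[≥] u, |f v| < |f u| + 1 :=
      (hf.1 u).tendsto.abs.eventually_lt_const (lt_add_one _)
    have hbound : ∀ᶠ v in 𝓝 u, |f v| ≤ max (|l| + 1) (|f u| + 1) := by
      rw [← nhdsLT_sup_nhdsGE u]
      exact eventually_sup.2 ⟨hleft.mono fun _ h => le_max_of_le_left h.le,
        hright.mono fun _ h => le_max_of_le_right h.le⟩
    exact ⟨_, mem_nhdsWithin_of_mem_nhds hbound, _, fun v hv => hv⟩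

lemma IsCadlag.tendsto_comp_gridCeil (hf : IsCadlag f) {u : ℝ≥0} (hu : u ∈ Ioc x y) :
    Tendsto (fun n => f (gridCeil x y n u)) atTop (𝓝 (f u)) :=
  (hf.1 u).tendsto.comp (tendsto_gridCeil hu)

lemma measurable_comp_gridCeil (f : ℝ≥0 → ℝ) (x y : ℝ≥0) (n : ℕ) :
    Measurable fun u => f (gridCeil x y n u) := by
  unfold gridCeil
  exact (measurable_from_nat (f := fun i => f (gridPoint x y n i))).comp (by fun_prop)

lemma IsCadlag.aestronglyMeasurable (hf : IsCadlag f) (μ : Measure ℝ≥0) :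
    AEStronglyMeasurable f (μ.restrict (Ioc x y)) := by
  refine aestronglyMeasurable_of_tendsto_ae atTop
    (fun n => (measurable_comp_gridCeil f x y n).aestronglyMeasurable) ?_
  filter_upwards [ae_restrict_mem measurableSet_Ioc] with u hu using hf.tendsto_comp_gridCeil hu

lemma IsCadlag.integrableOn_mul {μ : Measure ℝ≥0} (hf : IsCadlag f)
    (hg : IntegrableOn g (Ioc x y) μ) : IntegrableOn (fun u => f u * g u) (Ioc x y) μ := by
  obtain ⟨C, hC⟩ := hf.exists_abs_le x y
  refine hg.bdd_mul (c := C) (hf.aestronglyMeasurable μ) ?_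
  filter_upwards [ae_restrict_mem measurableSet_Ioc] with u hu using hC u (Ioc_subset_Icc_self hu)

lemma IsCadlag.integrableOn {μ : Measure ℝ≥0} [IsLocallyFiniteMeasure μ] (hf : IsCadlag f)
    (x y : ℝ≥0) : IntegrableOn f (Ioc x y) μ := by
  simpa using hf.integrableOn_mul (integrableOn_const (C := (1 : ℝ)) measure_Ioc_lt_top.ne)

lemma integral_comp_gridCeil_mul {μ : Measure ℝ≥0} (hg : IntegrableOn g (Ioc x y) μ)
    (hxy : x ≤ y) (f : ℝ≥0 → ℝ) (n : ℕ) :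
    ∫ u in Ioc x y, f (gridCeil x y n u) * g u ∂μ =
      ∑ i ∈ Finset.range (n + 1), f (gridPoint x y n (i + 1)) *
        ∫ u in Ioc (gridPoint x y n i) (gridPoint x y n (i + 1)), g u ∂μ := by
  have hcongr : ∀ i, EqOn (fun u => f (gridCeil x y n u) * g u)
      (fun u => f (gridPoint x y n (i + 1)) * g u)
      (Ioc (gridPoint x y n i) (gridPoint x y n (i + 1))) :=
    fun i u hu => by simp only [gridCeil_eq hu]
  have hdisj : Pairwise (Function.onFun Disjoint fun i =>
      Ioc (gridPoint x y n i) (gridPoint x y n (i + 1))) :=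
    (monotone_gridPoint x y n).pairwise_disjoint_on_Ioc_succ
  rw [← biUnion_Ioc_gridPoint hxy n, integral_biUnion_finset _ (fun _ _ => measurableSet_Ioc)
    (hdisj.set_pairwise _) fun i hi =>
      (integrableOn_congr_fun (hcongr i) measurableSet_Ioc).2 ((hg.mono_set
        (Ioc_gridPoint_subset hxy (Finset.mem_range.1 hi))).const_mul _)]
  refine Finset.sum_congr rfl fun i _ => ?_
  rw [setIntegral_congr_fun measurableSet_Ioc (hcongr i), integral_const_mul]

lemma IsCadlag.tendsto_sum_mul_setIntegral {μ : Measure ℝ≥0} (hf : IsCadlag f)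
    (hg : IntegrableOn g (Ioc x y) μ) (hxy : x ≤ y) :
    Tendsto (fun n => ∑ i ∈ Finset.range (n + 1), f (gridPoint x y n (i + 1)) *
        ∫ u in Ioc (gridPoint x y n i) (gridPoint x y n (i + 1)), g u ∂μ) atTop
      (𝓝 (∫ u in Ioc x y, f u * g u ∂μ)) := by
  obtain ⟨C, hC⟩ := hf.exists_abs_le x y
  simp_rw [← integral_comp_gridCeil_mul hg hxy]
  refine tendsto_integral_of_dominated_convergence (fun u => C * ‖g u‖) (fun n => ?_)
    (hg.norm.const_mul C) (fun n => ?_) ?_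
  · exact (measurable_comp_gridCeil f x y n).aestronglyMeasurable.mul hg.aestronglyMeasurable
  · filter_upwards [ae_restrict_mem measurableSet_Ioc] with u hu
    rw [norm_mul]
    gcongr
    exact hC _ ⟨hu.1.le.trans (le_gridCeil hu n), gridCeil_le hu n⟩
  · filter_upwards [ae_restrict_mem measurableSet_Ioc] with u hu
      using (hf.tendsto_comp_gridCeil hu).mul_const _

end Cadlag

/-! ### The Lebesgue–Stieltjes measure of a continuous path -/

section PathMeasure

variable {a : ℝ≥0 → ℝ} {x y : ℝ≥0}

instance (a : ℝ≥0 → ℝ) : IsLocallyFiniteMeasure (pathMeasure a) := by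
  unfold pathMeasure
  split_ifs <;> infer_instance

lemma pathMeasure_Ioc (hc : Continuous a) (hm : Monotone a) (x y : ℝ≥0) :
    pathMeasure a (Ioc x y) = ENNReal.ofReal (a y - a x) := by
  simp only [pathMeasure, dif_pos hm, StieltjesFunction.measure_Ioc, hm.stieltjesFunction_eq,
    hc.continuousWithinAt.rightLim_eq]

lemma nullSingletonClass_pathMeasure (hc : Continuous a) (hm : Monotone a) :
    NullSingletonClass (pathMeasure a) := by
  have ha : (hm.stieltjesFunction : ℝ≥0 → ℝ) = a :=
    funext fun u => by rw [hm.stieltjesFunction_eq, hc.continuousWithinAt.rightLim_eq]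
  refine ⟨fun u => ?_⟩
  rw [pathMeasure, dif_pos hm, StieltjesFunction.measure_singleton, ha,
    hc.continuousWithinAt.leftLim_eq, sub_self, ENNReal.ofReal_zero]

lemma exists_Ioc_inter_preimage_Iic_eq (hc : Continuous a) (hm : Monotone a) (hxy : x ≤ y) {b : ℝ}
    (hb : a x ≤ b) : ∃ z, a z = min b (a y) ∧ a ⁻¹' Iic b ∩ Ioc x y = Ioc x z := by
  obtain ⟨z, ⟨⟨-, hzy⟩, hzb⟩, hz⟩ :=
    (isCompact_Icc.inter_right (isClosed_Iic.preimage hc)).exists_isGreatest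
      (s := Icc x y ∩ a ⁻¹' Iic b) ⟨x, left_mem_Icc.2 hxy, hb⟩
  refine ⟨z, (le_min hzb (hm hzy)).antisymm ?_, ext fun u => ⟨?_, ?_⟩⟩
  · obtain ⟨w, hw, haw⟩ := intermediate_value_Icc hxy hc.continuousOn
      ⟨le_min hb (hm hxy), min_le_right b (a y)⟩
    exact haw ▸ hm (hz ⟨hw, haw.trans_le (min_le_left _ _)⟩)
  · exact fun ⟨hub, hxu, huy⟩ => ⟨hxu, hz ⟨⟨hxu.le, huy⟩, hub⟩⟩
  · exact fun ⟨hxu, huz⟩ => ⟨(hm huz).trans hzb, hxu, huz.trans hzy⟩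

lemma map_restrict_pathMeasure (hc : Continuous a) (hm : Monotone a) (hxy : x ≤ y) :
    ((pathMeasure a).restrict (Ioc x y)).map a = volume.restrict (Ioc (a x) (a y)) := by
  have : IsFiniteMeasure ((pathMeasure a).restrict (Ioc x y)) :=
    isFiniteMeasure_restrict.2 measure_Ioc_lt_top.ne
  refine Measure.ext_of_Iic _ _ fun b => ?_
  rw [Measure.map_apply hc.measurable measurableSet_Iic,
    Measure.restrict_apply (hc.measurable measurableSet_Iic),
    Measure.restrict_apply measurableSet_Iic, inter_comm (Iic b), Ioc_inter_Iic, Real.volume_Ioc]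
  rcases le_or_gt (a x) b with hb | hb
  · obtain ⟨z, hz, heq⟩ := exists_Ioc_inter_preimage_Iic_eq hc hm hxy hb
    rw [heq, pathMeasure_Ioc hc hm, hz, inf_comm]
  · have hempty : a ⁻¹' Iic b ∩ Ioc x y = ∅ :=
      eq_empty_of_forall_notMem fun u hu => ((hb.trans_le (hm hu.2.1.le)).trans_le hu.1).false
    rw [hempty, measure_empty, ENNReal.ofReal_of_nonpos]
    linarith [min_le_right (a y) b]

lemma integral_exp_neg (hc : Continuous a) (hm : Monotone a) (hxy : x ≤ y) :
    ∫ u in Ioc x y, Real.exp (-a u) ∂pathMeasure a = Real.exp (-a x) - Real.exp (-a y) := by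
  rw [← integral_map (φ := a) (f := fun v => Real.exp (-v)) hc.aemeasurable
    (by fun_prop), map_restrict_pathMeasure hc hm hxy, ← intervalIntegral.integral_of_le (hm hxy)]
  simp [intervalIntegral.integral_comp_neg]

lemma integrableOn_exp_neg (hc : Continuous a) (x y : ℝ≥0) :
    IntegrableOn (fun u => Real.exp (-a u)) (Ioc x y) (pathMeasure a) :=
  (hc.neg.rexp.continuousOn.integrableOn_compact isCompact_Icc).mono_set Ioc_subset_Icc_self

lemma integrableOn_mul_exp_neg {f : ℝ≥0 → ℝ} (hc : Continuous a)
    (hf : IntegrableOn f (Ioc x y) (pathMeasure a)) :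
    IntegrableOn (fun u => f u * Real.exp (-a u)) (Ioc x y) (pathMeasure a) :=
  hf.mul_continuousOn_of_subset hc.neg.rexp.continuousOn measurableSet_Ioc isCompact_Icc
    Ioc_subset_Icc_self

end PathMeasure

/-! ### Discounting along a path -/

lemma setIntegral_setIntegral_Ioc_mul {α : Type*} [LinearOrder α] [TopologicalSpace α]
    [OrderClosedTopology α] [SecondCountableTopology α] [MeasurableSpace α] [BorelSpace α]
    {μ : Measure α} [SFinite μ] {f g : α → ℝ} {x y : α} (hf : IntegrableOn f (Ioc x y) μ)
    (hg : IntegrableOn g (Ioc x y) μ) :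
    ∫ u in Ioc x y, (∫ v in Ioc x u, f v ∂μ) * g u ∂μ =
      ∫ v in Ioc x y, f v * ∫ u in Icc v y, g u ∂μ ∂μ := by
  have hT : MeasurableSet {z : α × α | z.1 ≤ z.2} := measurableSet_le measurable_fst measurable_snd
  have hinner : ∀ u ∈ Ioc x y, (∫ v in Ioc x u, f v ∂μ) * g u =
      ∫ v in Ioc x y, {z : α × α | z.1 ≤ z.2}.indicator (fun z => f z.1 * g z.2) (v, u) ∂μ := by
    intro u hu
    have h : (fun v => {z : α × α | z.1 ≤ z.2}.indicator (fun z => f z.1 * g z.2) (v, u)) =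
        (Iic u).indicator fun v => f v * g u := rfl
    rw [h, setIntegral_indicator measurableSet_Iic, Ioc_inter_Iic, inf_eq_right.2 hu.2,
      integral_mul_const]
  have houter : ∀ v ∈ Ioc x y, f v * ∫ u in Icc v y, g u ∂μ =
      ∫ u in Ioc x y, {z : α × α | z.1 ≤ z.2}.indicator (fun z => f z.1 * g z.2) (v, u) ∂μ := by
    intro v hv
    have h : (fun u => {z : α × α | z.1 ≤ z.2}.indicator (fun z => f z.1 * g z.2) (v, u)) =
        (Ici v).indicator fun u => f v * g u := rfl
    have hset : Ioc x y ∩ Ici v = Icc v y :=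
      ext fun u => ⟨fun hu => ⟨hu.2, hu.1.2⟩, fun hu => ⟨⟨hv.1.trans_le hu.1, hu.2⟩, hu.1⟩⟩
    rw [h, setIntegral_indicator measurableSet_Ici, hset, integral_const_mul]
  rw [setIntegral_congr_fun measurableSet_Ioc hinner,
    setIntegral_congr_fun measurableSet_Ioc houter]
  exact integral_integral_swap ((hf.mul_prod hg).indicator hT).swap

section Discount

variable {a f g : ℝ≥0 → ℝ} {c s : ℝ≥0}

/-- The path `f` discounted at rate `a`: it is `f 0 * exp (-a 0) + ∫_{(0, s]} e^{-a} df`, written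
in the integrated-by-parts form which makes sense for any locally integrable `f`. -/
noncomputable def discount (a f : ℝ≥0 → ℝ) (s : ℝ≥0) : ℝ :=
  f s * Real.exp (-a s) + ∫ u in Ioc 0 s, f u * Real.exp (-a u) ∂pathMeasure a

lemma discount_add (hc : Continuous a) (hf : IntegrableOn f (Ioc 0 s) (pathMeasure a))
    (hg : IntegrableOn g (Ioc 0 s) (pathMeasure a)) :
    discount a (fun u => f u + g u) s = discount a f s + discount a g s := by
  simp only [discount, add_mul]
  rw [integral_add (integrableOn_mul_exp_neg hc hf) (integrableOn_mul_exp_neg hc hg)]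
  ring

lemma discount_mono (hc : Continuous a) (hf : IntegrableOn f (Ioc 0 s) (pathMeasure a))
    (hg : IntegrableOn g (Ioc 0 s) (pathMeasure a)) (hfg : ∀ u ≤ s, f u ≤ g u) :
    discount a f s ≤ discount a g s := by
  refine add_le_add (by gcongr; exact hfg s le_rfl) ?_
  refine setIntegral_mono_on (integrableOn_mul_exp_neg hc hf) (integrableOn_mul_exp_neg hc hg)
    measurableSet_Ioc fun u hu => ?_
  gcongr
  exact hfg u hu.2

lemma discount_congr (hfg : ∀ u ≤ s, f u = g u) : discount a f s = discount a g s := by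
  have hfg' : EqOn (fun u => f u * Real.exp (-a u)) (fun u => g u * Real.exp (-a u)) (Ioc 0 s) :=
    fun u hu => by simp only [hfg u hu.2]
  rw [discount, discount, hfg s le_rfl, setIntegral_congr_fun measurableSet_Ioc hfg']

lemma discount_const (hc : Continuous a) (hm : Monotone a) (h : ℝ) (s : ℝ≥0) :
    discount a (fun _ => h) s = h * Real.exp (-a 0) := by
  rw [discount, integral_const_mul, integral_exp_neg hc hm zero_le]
  ring

lemma discount_setIntegral (hc : Continuous a) (hm : Monotone a)
    (hg : IntegrableOn g (Ioc 0 s) (pathMeasure a)) :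
    discount a (fun u => ∫ r in Ioc 0 u, g r ∂pathMeasure a) s =
      ∫ u in Ioc 0 s, g u * Real.exp (-a u) ∂pathMeasure a := by
  have := nullSingletonClass_pathMeasure hc hm
  have hinner : EqOn (fun r => g r * ∫ u in Icc r s, Real.exp (-a u) ∂pathMeasure a)
      (fun r => g r * Real.exp (-a r) - g r * Real.exp (-a s)) (Ioc 0 s) := fun r hr => by
    simp only [integral_Icc_eq_integral_Ioc, integral_exp_neg hc hm hr.2, mul_sub]
  rw [discount, setIntegral_setIntegral_Ioc_mul hg (integrableOn_exp_neg hc 0 s),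
    setIntegral_congr_fun measurableSet_Ioc hinner,
    integral_sub (integrableOn_mul_exp_neg hc hg) (hg.mul_const _), integral_mul_const]
  ring

lemma discount_sub_discount (hc : Continuous a) {x y : ℝ≥0} (hxy : x ≤ y)
    (hf : IntegrableOn f (Ioc 0 y) (pathMeasure a)) :
    discount a f y - discount a f x = f y * Real.exp (-a y) - f x * Real.exp (-a x) +
      ∫ u in Ioc x y, f u * Real.exp (-a u) ∂pathMeasure a := by
  have hfe := integrableOn_mul_exp_neg hc hf
  rw [discount, discount, ← Ioc_union_Ioc_eq_Ioc zero_le hxy,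
    setIntegral_union (Ioc_disjoint_Ioc_of_le le_rfl) measurableSet_Ioc
      (hfe.mono_set (Ioc_subset_Ioc_right hxy)) (hfe.mono_set (Ioc_subset_Ioc_left zero_le))]
  ring

lemma discount_min (hc : Continuous a) (hm : Monotone a) (hcs : c ≤ s)
    (hf : IntegrableOn (fun u => f (min u c)) (Ioc 0 s) (pathMeasure a)) :
    discount a (fun u => f (min u c)) s = discount a f c := by
  have hconst : EqOn (fun u => f (min u c) * Real.exp (-a u)) (fun u => f c * Real.exp (-a u))
      (Ioc c s) := fun u hu => by simp only [min_eq_right hu.1.le]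
  have hsub := discount_sub_discount hc hcs hf
  rw [setIntegral_congr_fun measurableSet_Ioc hconst, integral_const_mul,
    integral_exp_neg hc hm hcs, min_self, min_eq_right hcs] at hsub
  rw [discount_congr (f := f) (g := fun u => f (min u c)) fun u hu => by rw [min_eq_left hu]]
  linarith

/-- Discounting both sides turns the Gronwall term `∫ ξ da` into `∫ ξ e^{-a} da`, which is also
the integral term of `discount a ξ`. -/
lemma mul_exp_neg_le_of_le_integral {ξ : ℝ≥0 → ℝ} (hc : Continuous a) (hm : Monotone a) {h : ℝ}
    (hξ : IntegrableOn ξ (Ioc 0 s) (pathMeasure a)) (hξ_nonneg : ∀ u, 0 ≤ ξ u)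
    (hf : IntegrableOn f (Ioc 0 s) (pathMeasure a))
    (hle : ∀ u ≤ s, ξ u ≤ h + (∫ r in Ioc 0 u, ξ r ∂pathMeasure a) + f u) :
    ξ s * Real.exp (-a s) ≤ h * Real.exp (-a 0) + discount a f s := by
  set G : ℝ≥0 → ℝ := fun u => ∫ r in Ioc 0 u, ξ r ∂pathMeasure a
  have hG_mono : MonotoneOn G (Icc 0 s) := fun u _ v hv huv =>
    setIntegral_mono_set (hξ.mono_set (Ioc_subset_Ioc_right hv.2)) (ae_of_all _ hξ_nonneg)
      (Ioc_subset_Ioc_right huv).eventuallyLE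
  have hG : IntegrableOn G (Ioc 0 s) (pathMeasure a) :=
    (hG_mono.integrableOn_isCompact isCompact_Icc).mono_set Ioc_subset_Icc_self
  have hh : IntegrableOn (fun _ => h) (Ioc 0 s) (pathMeasure a) :=
    integrableOn_const measure_Ioc_lt_top.ne
  have key : discount a ξ s ≤ h * Real.exp (-a 0) +
      (∫ u in Ioc 0 s, ξ u * Real.exp (-a u) ∂pathMeasure a) + discount a f s := by
    rw [← discount_const hc hm h s, ← discount_setIntegral hc hm hξ, ← discount_add hc hh hG,
      ← discount_add (f := fun u => h + G u) hc (hh.add hG) hf]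
    exact discount_mono hc hξ ((hh.add hG).add hf) hle
  rw [discount] at key
  linarith

end Discount

/-! ### Right-endpoint Riemann sums of a martingale -/

section RiemannSum

variable {Ω : Type*} {mΩ : MeasurableSpace Ω} {P : Measure Ω} {𝓕 : Filtration ℝ≥0 mΩ}
  {Y Z W : ℝ≥0 → Ω → ℝ} {r : ℕ → ℝ≥0} {m : ℕ}

/-- A nonincreasing adapted process with values in `[0, 1]`, such as `e^{-A}`. -/
structure IsDiscountFactor (W : ℝ≥0 → Ω → ℝ) (𝓕 : Filtration ℝ≥0 mΩ) (P : Measure Ω) : Prop where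
  adapted : StronglyAdapted 𝓕 W
  mem_Icc : ∀ᵐ ω ∂P, ∀ s, W s ω ∈ Icc 0 1
  antitone : ∀ᵐ ω ∂P, Antitone fun s => W s ω

/-- The sum `∑ Y (r (i + 1)) (W (r i) - W (r (i + 1)))` over the first `m` cells of the partition
`r`, an approximation of `-∫ Y dW`. -/
noncomputable def rightSum (Y W : ℝ≥0 → Ω → ℝ) (r : ℕ → ℝ≥0) (m : ℕ) (ω : Ω) : ℝ :=
  ∑ i ∈ Finset.range m, Y (r (i + 1)) ω * (W (r i) ω - W (r (i + 1)) ω)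

lemma IsDiscountFactor.integrable_mul (hW : IsDiscountFactor W 𝓕 P) {X : Ω → ℝ}
    (hX : Integrable X P) (s : ℝ≥0) : Integrable (fun ω => X ω * W s ω) P := by
  refine hX.mul_bdd (c := 1) ((hW.adapted s).mono (𝓕.le s)).aestronglyMeasurable ?_
  filter_upwards [hW.mem_Icc] with ω h
  rw [Real.norm_of_nonneg (h s).1]
  exact (h s).2

lemma IsDiscountFactor.integrable_mul_sub (hW : IsDiscountFactor W 𝓕 P) {X : Ω → ℝ}
    (hX : Integrable X P) (s u : ℝ≥0) : Integrable (fun ω => X ω * (W s ω - W u ω)) P := by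
  simp only [mul_sub]
  exact (hW.integrable_mul hX s).sub (hW.integrable_mul hX u)

lemma IsDiscountFactor.integrable_rightSum (hW : IsDiscountFactor W 𝓕 P)
    (hY : ∀ s, Integrable (Y s) P) (r : ℕ → ℝ≥0) (m : ℕ) : Integrable (rightSum Y W r m) P :=
  integrable_finsetSum _ fun _ _ => hW.integrable_mul_sub (hY _) _ _

lemma IsDiscountFactor.setIntegral_mul_eq [IsFiniteMeasure P] (hW : IsDiscountFactor W 𝓕 P)
    (hY : Martingale Y 𝓕 P) {s u : ℝ≥0} (hsu : s ≤ u) {B : Set Ω} (hB : MeasurableSet[𝓕 s] B) :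
    ∫ ω in B, Y u ω * W s ω ∂P = ∫ ω in B, Y s ω * W s ω ∂P := by
  have hpull : P[Y u * W s | 𝓕 s] =ᵐ[P] P[Y u | 𝓕 s] * W s :=
    condExp_mul_of_stronglyMeasurable_right (hW.adapted s) (hW.integrable_mul (hY.integrable u) s)
      (hY.integrable u)
  calc ∫ ω in B, Y u ω * W s ω ∂P
      = ∫ ω in B, (P[Y u * W s | 𝓕 s]) ω ∂P :=
        (setIntegral_condExp (𝓕.le s) (hW.integrable_mul (hY.integrable u) s) hB).symm
    _ = ∫ ω in B, Y s ω * W s ω ∂P := by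
        refine setIntegral_congr_ae (𝓕.le s _ hB) ?_
        filter_upwards [hpull, hY.condExp_ae_eq hsu] with ω h h' _
        rw [h, Pi.mul_apply, h']

lemma IsDiscountFactor.setIntegral_rightSum [IsFiniteMeasure P] (hW : IsDiscountFactor W 𝓕 P)
    (hY : Martingale Y 𝓕 P) (hr : Monotone r) (m : ℕ) {B : Set Ω}
    (hB : MeasurableSet[𝓕 (r 0)] B) :
    ∫ ω in B, rightSum Y W r m ω ∂P =
      (∫ ω in B, Y (r 0) ω * W (r 0) ω ∂P) - ∫ ω in B, Y (r m) ω * W (r m) ω ∂P := by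
  have hint : ∀ u v, IntegrableOn (fun ω => Y u ω * W v ω) B P := fun u v =>
    (hW.integrable_mul (hY.integrable u) v).integrableOn
  have hcell : ∀ i, ∫ ω in B, Y (r (i + 1)) ω * (W (r i) ω - W (r (i + 1)) ω) ∂P =
      (∫ ω in B, Y (r i) ω * W (r i) ω ∂P) -
        ∫ ω in B, Y (r (i + 1)) ω * W (r (i + 1)) ω ∂P := fun i => by
    simp only [mul_sub]
    rw [integral_sub (hint _ _) (hint _ _),
      hW.setIntegral_mul_eq hY (hr i.le_succ) (𝓕.mono (hr i.zero_le) _ hB)]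
  simp only [rightSum]
  rw [integral_finsetSum _ fun i _ => (hW.integrable_mul_sub (hY.integrable _) _ _).integrableOn,
    Finset.sum_congr rfl fun i _ => hcell i,
    Finset.sum_range_sub' (fun i => ∫ ω in B, Y (r i) ω * W (r i) ω ∂P)]

lemma rightSum_nonneg (hr : Monotone r) {ω : Ω} (hW_anti : Antitone fun s => W s ω)
    (hZ : ∀ i, 0 ≤ Z (r i) ω) : 0 ≤ rightSum Z W r m ω :=
  Finset.sum_nonneg fun i _ => mul_nonneg (hZ _) (sub_nonneg.2 (hW_anti (hr i.le_succ)))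

lemma IsDiscountFactor.integral_rightSum_le [IsFiniteMeasure P] (hW : IsDiscountFactor W 𝓕 P)
    (hZ : Martingale Z 𝓕 P) (hZ_nonneg : ∀ s, 0 ≤ᵐ[P] Z s) (hr : Monotone r) (m : ℕ) :
    ∫ ω, rightSum Z W r m ω ∂P ≤ ∫ ω, Z (r 0) ω ∂P := by
  have htelescope := hW.setIntegral_rightSum hZ hr m MeasurableSet.univ
  simp only [setIntegral_univ] at htelescope
  have hlast : 0 ≤ ∫ ω, Z (r m) ω * W (r m) ω ∂P := by
    refine integral_nonneg_of_ae ?_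
    filter_upwards [hZ_nonneg (r m), hW.mem_Icc] with ω hZ hW using mul_nonneg hZ (hW _).1
  have hfirst : ∫ ω, Z (r 0) ω * W (r 0) ω ∂P ≤ ∫ ω, Z (r 0) ω ∂P := by
    refine integral_mono_ae (hW.integrable_mul (hZ.integrable _) _) (hZ.integrable _) ?_
    filter_upwards [hZ_nonneg (r 0), hW.mem_Icc] with ω hZ hW
      using mul_le_of_le_one_right hZ (hW _).2
  linarith

lemma abs_rightSum_le (hr : Monotone r) {K : ℝ} {ω : Ω} (hK : 0 ≤ K)
    (hW : ∀ s, W s ω ∈ Icc 0 1) (hW_anti : Antitone fun s => W s ω)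
    (hYZ : ∀ i ≤ m, |Y (r i) ω| ≤ K + Z (r i) ω) :
    |rightSum Y W r m ω| ≤ K + rightSum Z W r m ω := by
  calc |rightSum Y W r m ω|
      ≤ ∑ i ∈ Finset.range m, |Y (r (i + 1)) ω * (W (r i) ω - W (r (i + 1)) ω)| :=
        Finset.abs_sum_le_sum_abs _ _
    _ ≤ ∑ i ∈ Finset.range m, (K + Z (r (i + 1)) ω) * (W (r i) ω - W (r (i + 1)) ω) := by
        refine Finset.sum_le_sum fun i hi => ?_
        have hΔ : 0 ≤ W (r i) ω - W (r (i + 1)) ω := sub_nonneg.2 (hW_anti (hr i.le_succ))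
        rw [abs_mul, abs_of_nonneg hΔ]
        gcongr
        exact hYZ _ (Finset.mem_range.1 hi)
    _ = K * (W (r 0) ω - W (r m) ω) + rightSum Z W r m ω := by
        simp only [add_mul, Finset.sum_add_distrib, ← Finset.mul_sum, rightSum]
        rw [Finset.sum_range_sub' (fun i => W (r i) ω)]
    _ ≤ K + rightSum Z W r m ω := by
        gcongr
        exact mul_le_of_le_one_right hK (by linarith [(hW (r 0)).2, (hW (r m)).1])

lemma integrable_excess [IsFiniteMeasure P] {X : Ω → ℝ} (hX : Integrable X P) (K : ℝ) :
    Integrable (fun ω => max (|X ω| - K) 0) P :=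
  (hX.abs.sub (integrable_const K)).pos_part

lemma tendsto_integral_excess [IsFiniteMeasure P] {X : Ω → ℝ} (hX : Integrable X P) :
    Tendsto (fun K : ℕ => ∫ ω, max (|X ω| - K) 0 ∂P) atTop (𝓝 0) := by
  suffices Tendsto (fun K : ℕ => ∫ ω, max (|X ω| - K) 0 ∂P) atTop (𝓝 (∫ _, 0 ∂P)) by
    simpa only [integral_zero] using this
  refine tendsto_integral_of_dominated_convergence (fun ω => |X ω|)
    (fun K => (integrable_excess hX K).aestronglyMeasurable) hX.abs ?_ ?_
  · refine fun K => ae_of_all _ fun ω => ?_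
    rw [Real.norm_of_nonneg (le_max_right _ _)]
    exact max_le (sub_le_self _ K.cast_nonneg) (abs_nonneg _)
  · refine ae_of_all _ fun ω => tendsto_const_nhds.congr' ?_
    filter_upwards [eventually_ge_atTop ⌈|X ω|⌉₊] with K hK
    exact (max_eq_right (sub_nonpos.2 (Nat.ceil_le.1 hK))).symm

lemma abs_le_add_condExp_excess [IsFiniteMeasure P] (hY : Martingale Y 𝓕 P) (K : ℝ) {s T : ℝ≥0}
    (hs : s ≤ T) : ∀ᵐ ω ∂P, |Y s ω| ≤ K + (P[fun ω => max (|Y T ω| - K) 0 | 𝓕 s]) ω := by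
  have hexcess := integrable_excess (hY.integrable T) K
  have hmono : P[fun ω => |Y T ω| | 𝓕 s] ≤ᵐ[P]
      P[(fun _ => K) + fun ω => max (|Y T ω| - K) 0 | 𝓕 s] :=
    condExp_mono (hY.integrable T).abs ((integrable_const K).add hexcess)
      (ae_of_all _ fun ω => sub_le_iff_le_add'.1 (le_max_left _ _))
  filter_upwards [abs_condExp_ae_le_condExp_abs (m := 𝓕 s) (μ := P) (Y T), hmono,
    condExp_add (m := 𝓕 s) (integrable_const K) hexcess, hY.condExp_ae_eq hs]
    with ω habs hle hadd heq
  rw [Pi.abs_apply, heq] at habs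
  rw [hadd, Pi.add_apply, condExp_const (𝓕.le s)] at hle
  exact habs.trans hle

/-- The excess of `|Y|` over `K` is dominated by a nonnegative martingale `Z`, and the integral of
a Riemann sum of a martingale telescopes. -/
lemma IsDiscountFactor.eLpNorm_indicator_rightSum_le [IsFiniteMeasure P]
    (hW : IsDiscountFactor W 𝓕 P) (hY : Martingale Y 𝓕 P) (hr : Monotone r) {T : ℝ≥0}
    (hT : r m ≤ T) {K : ℝ} (hK : 0 ≤ K) {E : Set Ω} (hE : MeasurableSet E) :
    eLpNorm (E.indicator (rightSum Y W r m)) 1 P ≤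
      ENNReal.ofReal K * P E + ENNReal.ofReal (∫ ω, max (|Y T ω| - K) 0 ∂P) := by
  set Z : ℝ≥0 → Ω → ℝ := fun s => P[fun ω => max (|Y T ω| - K) 0 | 𝓕 s]
  have hZ : Martingale Z 𝓕 P := martingale_condExp _ 𝓕 P
  have hZ_nonneg : ∀ s, 0 ≤ᵐ[P] Z s := fun s =>
    condExp_nonneg (ae_of_all _ fun ω => le_max_right _ _)
  have hYZ : ∀ᵐ ω ∂P, ∀ i ≤ m, |Y (r i) ω| ≤ K + Z (r i) ω :=
    ae_all_iff.2 fun i => ae_all_iff.2 fun hi => abs_le_add_condExp_excess hY K ((hr hi).trans hT)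
  have hsum_int : Integrable (rightSum Z W r m) P := hW.integrable_rightSum hZ.integrable r m
  have hsum_nonneg : 0 ≤ᵐ[P] rightSum Z W r m := by
    filter_upwards [ae_all_iff.2 fun i => hZ_nonneg (r i), hW.antitone] with ω h h_anti
      using rightSum_nonneg hr h_anti h
  have hsum_norm :
      eLpNorm (rightSum Z W r m) 1 P = ENNReal.ofReal (∫ ω, rightSum Z W r m ω ∂P) := by
    rw [eLpNorm_one_eq_lintegral_enorm, ← ofReal_integral_norm_eq_lintegral_enorm hsum_int]
    exact congrArg _ (integral_congr_ae (hsum_nonneg.mono fun ω h => Real.norm_of_nonneg h))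
  have hsum_le : ∫ ω, rightSum Z W r m ω ∂P ≤ ∫ ω, max (|Y T ω| - K) 0 ∂P :=
    (hW.integral_rightSum_le hZ hZ_nonneg hr m).trans_eq (integral_condExp (𝓕.le _))
  calc eLpNorm (E.indicator (rightSum Y W r m)) 1 P
      ≤ eLpNorm ((E.indicator fun _ => K) + rightSum Z W r m) 1 P := by
        refine eLpNorm_mono_ae ?_
        filter_upwards [hYZ, hW.mem_Icc, hW.antitone] with ω hYZ hW hW_anti
        by_cases hω : ω ∈ E
        · simpa [hω] using (abs_rightSum_le hr hK hW hW_anti hYZ).trans (le_abs_self _)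
        · simp [hω]
    _ ≤ eLpNorm (E.indicator fun _ => K) 1 P + eLpNorm (rightSum Z W r m) 1 P :=
        eLpNorm_add_le (aestronglyMeasurable_const.indicator hE) hsum_int.aestronglyMeasurable
          le_rfl
    _ ≤ ENNReal.ofReal K * P E + ENNReal.ofReal (∫ ω, max (|Y T ω| - K) 0 ∂P) := by
        rw [hsum_norm, eLpNorm_indicator_const hE one_ne_zero ENNReal.one_ne_top]
        gcongr
        · rw [Real.enorm_of_nonneg hK]
        · simp

lemma IsDiscountFactor.uniformIntegrable_rightSum [IsFiniteMeasure P] (hW : IsDiscountFactor W 𝓕 P)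
    (hY : Martingale Y 𝓕 P) {r : ℕ → ℕ → ℝ≥0} (hr : ∀ n, Monotone (r n)) {T : ℝ≥0} {m : ℕ → ℕ}
    (hT : ∀ n, r n (m n) ≤ T) : UniformIntegrable (fun n => rightSum Y W (r n) (m n)) 1 P := by
  refine ⟨fun n => (hW.integrable_rightSum hY.integrable _ _).aestronglyMeasurable,
    fun ε hε => ?_, (∫ ω, max (|Y T ω| - 0) 0 ∂P).toNNReal, fun n => ?_⟩
  · obtain ⟨K, hK⟩ :=
      ((tendsto_integral_excess (hY.integrable T)).eventually_lt_const (half_pos hε)).exists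
    refine ⟨ε / (2 * (K + 1)), by positivity, fun n E hE hPE => ?_⟩
    have hmul : (K : ℝ) * (ε / (2 * (K + 1))) ≤ ε / 2 := by
      rw [← div_div, mul_div_left_comm]
      exact mul_le_of_le_one_right (half_pos hε).le (div_le_one_of_le₀ (by simp) (by positivity))
    calc eLpNorm (E.indicator (rightSum Y W (r n) (m n))) 1 P
        ≤ ENNReal.ofReal K * P E + ENNReal.ofReal (∫ ω, max (|Y T ω| - K) 0 ∂P) :=
          hW.eLpNorm_indicator_rightSum_le hY (hr n) (hT n) K.cast_nonneg hE
      _ ≤ ENNReal.ofReal K * ENNReal.ofReal (ε / (2 * (K + 1))) + ENNReal.ofReal (ε / 2) := by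
          gcongr
      _ ≤ ENNReal.ofReal ε := by
          rw [← ENNReal.ofReal_mul K.cast_nonneg,
            ← ENNReal.ofReal_add (by positivity) (by positivity)]
          exact ENNReal.ofReal_le_ofReal (by linarith)
  · simpa [ENNReal.ofReal] using
      hW.eLpNorm_indicator_rightSum_le hY (hr n) (hT n) le_rfl MeasurableSet.univ

end RiemannSum

/-! ### The discounted martingale -/

section Discounted

variable {Ω : Type*} {mΩ : MeasurableSpace Ω} {P : Measure Ω} {𝓕 : Filtration ℝ≥0 mΩ}
  {Y A : ℝ≥0 → Ω → ℝ} {x y : ℝ≥0}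

/-- An increasing process in the sense of stochastic analysis: adapted, started at `0`, with
continuous nondecreasing paths. -/
structure IsIncreasingProcess (A : ℝ≥0 → Ω → ℝ) (𝓕 : Filtration ℝ≥0 mΩ) (P : Measure Ω) :
    Prop where
  adapted : StronglyAdapted 𝓕 A
  cont : ∀ᵐ ω ∂P, Continuous fun s => A s ω
  mono : ∀ᵐ ω ∂P, Monotone fun s => A s ω
  zero : ∀ᵐ ω ∂P, A 0 ω = 0

namespace IsIncreasingProcess

lemma nonneg (hA : IsIncreasingProcess A 𝓕 P) : ∀ᵐ ω ∂P, ∀ s, 0 ≤ A s ω := by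
  filter_upwards [hA.mono, hA.zero] with ω hm h0 s using h0.ge.trans (hm zero_le)

lemma isDiscountFactor (hA : IsIncreasingProcess A 𝓕 P) :
    IsDiscountFactor (fun s ω => Real.exp (-A s ω)) 𝓕 P where
  adapted s := Real.continuous_exp.comp_stronglyMeasurable (hA.adapted s).neg
  mem_Icc := by
    filter_upwards [hA.nonneg] with ω h s
    exact ⟨(Real.exp_pos _).le, Real.exp_le_one_iff.2 (neg_nonpos.2 (h s))⟩
  antitone := by
    filter_upwards [hA.mono] with ω hm u v huv
      using Real.exp_le_exp.2 (neg_le_neg (hm huv))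

lemma ae_tendsto_rightSum (hA : IsIncreasingProcess A 𝓕 P)
    (hY : ∀ᵐ ω ∂P, IsCadlag fun s => Y s ω) (hxy : x ≤ y) :
    ∀ᵐ ω ∂P, Tendsto
      (fun n => rightSum Y (fun s ω => Real.exp (-A s ω)) (gridPoint x y n) (n + 1) ω) atTop
      (𝓝 (∫ u in Ioc x y, Y u ω * Real.exp (-A u ω) ∂pathMeasure fun s => A s ω)) := by
  filter_upwards [hA.cont, hA.mono, hY] with ω hc hm hY
  refine (hY.tendsto_sum_mul_setIntegral (integrableOn_exp_neg hc x y) hxy).congr fun n => ?_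
  exact Finset.sum_congr rfl fun i _ => by
    rw [integral_exp_neg hc hm (monotone_gridPoint x y n i.le_succ)]

variable [IsFiniteMeasure P]

lemma integrable_setIntegral (hA : IsIncreasingProcess A 𝓕 P) (hY : Martingale Y 𝓕 P)
    (hY_cadlag : ∀ᵐ ω ∂P, IsCadlag fun s => Y s ω) (hxy : x ≤ y) :
    Integrable
      (fun ω => ∫ u in Ioc x y, Y u ω * Real.exp (-A u ω) ∂pathMeasure fun s => A s ω) P :=
  memLp_one_iff_integrable.1 <| (hA.isDiscountFactor.uniformIntegrable_rightSum hY
    (monotone_gridPoint x y) fun n => (gridPoint_last hxy n).le).memLp_of_ae_tendsto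
      (hA.ae_tendsto_rightSum hY_cadlag hxy)

lemma setIntegral_setIntegral (hA : IsIncreasingProcess A 𝓕 P) (hY : Martingale Y 𝓕 P)
    (hY_cadlag : ∀ᵐ ω ∂P, IsCadlag fun s => Y s ω) (hxy : x ≤ y) {B : Set Ω}
    (hB : MeasurableSet[𝓕 x] B) :
    ∫ ω in B, (∫ u in Ioc x y, Y u ω * Real.exp (-A u ω) ∂pathMeasure fun s => A s ω) ∂P =
      (∫ ω in B, Y x ω * Real.exp (-A x ω) ∂P) - ∫ ω in B, Y y ω * Real.exp (-A y ω) ∂P := by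
  have hW := hA.isDiscountFactor
  have hui := hW.uniformIntegrable_rightSum hY (monotone_gridPoint x y) fun n =>
    (gridPoint_last hxy n).le
  have hint := hA.integrable_setIntegral hY hY_cadlag hxy
  have hL1 := tendsto_Lp_finite_of_tendsto_ae le_rfl ENNReal.one_ne_top hui.1
    (memLp_one_iff_integrable.2 hint) hui.2.1 (hA.ae_tendsto_rightSum hY_cadlag hxy)
  refine tendsto_nhds_unique (tendsto_setIntegral_of_L1' _ hint.aestronglyMeasurable
    (Eventually.of_forall fun n => hW.integrable_rightSum hY.integrable _ _) hL1 B)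
    (tendsto_const_nhds.congr fun n => ?_)
  rw [hW.setIntegral_rightSum hY (monotone_gridPoint x y n) (n + 1) (by rwa [gridPoint_zero]),
    gridPoint_zero, gridPoint_last hxy]

lemma integrable_discount (hA : IsIncreasingProcess A 𝓕 P) (hY : Martingale Y 𝓕 P)
    (hY_cadlag : ∀ᵐ ω ∂P, IsCadlag fun s => Y s ω) (s : ℝ≥0) :
    Integrable (fun ω => discount (fun u => A u ω) (fun u => Y u ω) s) P :=
  (hA.isDiscountFactor.integrable_mul (hY.integrable s) s).add
    (hA.integrable_setIntegral hY hY_cadlag zero_le)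

lemma setIntegral_discount (hA : IsIncreasingProcess A 𝓕 P) (hY : Martingale Y 𝓕 P)
    (hY_cadlag : ∀ᵐ ω ∂P, IsCadlag fun s => Y s ω) (hxy : x ≤ y) {B : Set Ω}
    (hB : MeasurableSet[𝓕 x] B) :
    ∫ ω in B, discount (fun u => A u ω) (fun u => Y u ω) y ∂P =
      ∫ ω in B, discount (fun u => A u ω) (fun u => Y u ω) x ∂P := by
  have hint := hA.integrable_discount hY hY_cadlag
  have hmul : ∀ s, IntegrableOn (fun ω => Y s ω * Real.exp (-A s ω)) B P := fun s =>
    (hA.isDiscountFactor.integrable_mul (hY.integrable s) s).integrableOn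
  have hsub : IntegrableOn (fun ω => Y y ω * Real.exp (-A y ω) - Y x ω * Real.exp (-A x ω)) B P :=
    (hmul y).sub (hmul x)
  have hincr : ∀ᵐ ω ∂P.restrict B,
      discount (fun u => A u ω) (fun u => Y u ω) y - discount (fun u => A u ω) (fun u => Y u ω) x =
        Y y ω * Real.exp (-A y ω) - Y x ω * Real.exp (-A x ω) +
          ∫ u in Ioc x y, Y u ω * Real.exp (-A u ω) ∂pathMeasure fun s => A s ω := by
    filter_upwards [ae_restrict_of_ae hA.cont, ae_restrict_of_ae hY_cadlag] with ω hc hY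
      using discount_sub_discount hc hxy (hY.integrableOn 0 y)
  rw [← sub_eq_zero, ← integral_sub (hint y).integrableOn (hint x).integrableOn,
    integral_congr_ae hincr,
    integral_add hsub (hA.integrable_setIntegral hY hY_cadlag hxy).integrableOn,
    integral_sub (hmul y) (hmul x),
    hA.setIntegral_setIntegral hY hY_cadlag hxy hB]
  ring

lemma integral_discount_eq_zero (hA : IsIncreasingProcess A 𝓕 P) (hY : Martingale Y 𝓕 P)
    (hY_cadlag : ∀ᵐ ω ∂P, IsCadlag fun s => Y s ω) (hY_zero : ∀ᵐ ω ∂P, Y 0 ω = 0) (s : ℝ≥0) :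
    ∫ ω, discount (fun u => A u ω) (fun u => Y u ω) s ∂P = 0 := by
  rw [← setIntegral_univ, hA.setIntegral_discount hY hY_cadlag zero_le MeasurableSet.univ,
    setIntegral_univ]
  refine integral_eq_zero_of_ae ?_
  filter_upwards [hY_zero] with ω h
  simp [discount, h]

end IsIncreasingProcess

end Discounted

/-! ### A maximal inequality -/

section Maximal

variable {Ω : Type*} {mΩ : MeasurableSpace Ω} {P : Measure Ω}

lemma measurableSet_disjointed {ι : Type*} [Preorder ι] {𝓖 : Filtration ι mΩ} {r : ℕ → ι}
    (hr : Monotone r) {C : ℕ → Set Ω} (hC : ∀ i, MeasurableSet[𝓖 (r i)] (C i)) (i : ℕ) :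
    MeasurableSet[𝓖 (r i)] (disjointed C i) := by
  rw [disjointed_eq_inter_compl]
  exact (hC i).inter (MeasurableSet.biInter (to_countable _) fun j hj =>
    (𝓖.mono (hr (mem_Iio.1 hj).le) _ (hC j)).compl)

lemma setLIntegral_ofReal_le_of_setIntegral_eq {X N V : Ω → ℝ} {B : Set Ω} (hB : MeasurableSet B)
    (hX : IntegrableOn X B P) (hN : IntegrableOn N B P) (hN_nonneg : 0 ≤ᵐ[P] N)
    (hV_nonneg : 0 ≤ᵐ[P] V) (hNX : ∫ ω in B, N ω ∂P = ∫ ω in B, X ω ∂P)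
    (hVX : ∀ᵐ ω ∂P, ω ∈ B → V ω ≤ X ω) :
    ∫⁻ ω in B, ENNReal.ofReal (V ω) ∂P ≤ ∫⁻ ω in B, ENNReal.ofReal (N ω) ∂P := by
  rw [← ae_restrict_iff' hB] at hVX
  have hX_nonneg : 0 ≤ᵐ[P.restrict B] X := by
    filter_upwards [hVX, ae_restrict_of_ae hV_nonneg] with ω hVX hV using hV.trans hVX
  calc ∫⁻ ω in B, ENNReal.ofReal (V ω) ∂P
      ≤ ∫⁻ ω in B, ENNReal.ofReal (X ω) ∂P :=
        lintegral_mono_ae (hVX.mono fun ω => ENNReal.ofReal_le_ofReal)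
    _ = ENNReal.ofReal (∫ ω in B, N ω ∂P) := by
        rw [hNX, ofReal_integral_eq_lintegral_ofReal hX hX_nonneg]
    _ = ∫⁻ ω in B, ENNReal.ofReal (N ω) ∂P :=
        ofReal_integral_eq_lintegral_ofReal hN (ae_restrict_of_ae hN_nonneg)

/-- Decomposing the union by the first index `i` such that `ω ∈ C i` turns this into a statement
about each `C i`, as in the proof of Doob's maximal inequality. -/
lemma setLIntegral_biUnion_le_integral {ι : Type*} [Preorder ι] {𝓖 : Filtration ι mΩ} {r : ℕ → ι}
    (hr : Monotone r) {m : ℕ} {X : ℕ → Ω → ℝ} {N V : Ω → ℝ} (hX : ∀ i, Integrable (X i) P)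
    (hN : Integrable N P) (hN_nonneg : 0 ≤ᵐ[P] N) (hV_nonneg : 0 ≤ᵐ[P] V)
    (hNX : ∀ i ≤ m, ∀ B, MeasurableSet[𝓖 (r i)] B → ∫ ω in B, N ω ∂P = ∫ ω in B, X i ω ∂P)
    {C : ℕ → Set Ω} (hC : ∀ i, MeasurableSet[𝓖 (r i)] (C i))
    (hVX : ∀ i ≤ m, ∀ᵐ ω ∂P, ω ∈ C i → V ω ≤ X i ω) :
    ∫⁻ ω in ⋃ i ∈ Finset.range (m + 1), C i, ENNReal.ofReal (V ω) ∂P ≤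
      ENNReal.ofReal (∫ ω, N ω ∂P) := by
  set B := disjointed C
  have hB : ∀ i, MeasurableSet[𝓖 (r i)] (B i) := measurableSet_disjointed hr hC
  have hBm : ∀ i, MeasurableSet (B i) := fun i => 𝓖.le _ _ (hB i)
  have hdisj : (↑(Finset.range (m + 1)) : Set ℕ).PairwiseDisjoint B :=
    (disjoint_disjointed C).set_pairwise _
  have hunion : ⋃ i ∈ Finset.range (m + 1), C i = ⋃ i ∈ Finset.range (m + 1), B i :=
    (partialSups_eq_biUnion_range C m).symm.trans (biUnion_range_succ_disjointed C m).symm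
  have hcell : ∀ i ∈ Finset.range (m + 1), ∫⁻ ω in B i, ENNReal.ofReal (V ω) ∂P ≤
      ∫⁻ ω in B i, ENNReal.ofReal (N ω) ∂P := fun i hi => by
    have hi := Finset.mem_range_succ_iff.1 hi
    refine setLIntegral_ofReal_le_of_setIntegral_eq (hBm i) (hX i).integrableOn hN.integrableOn
      hN_nonneg hV_nonneg (hNX i hi _ (hB i)) ?_
    filter_upwards [hVX i hi] with ω hω hmem using hω (disjointed_subset C i hmem)
  calc ∫⁻ ω in ⋃ i ∈ Finset.range (m + 1), C i, ENNReal.ofReal (V ω) ∂P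
      = ∑ i ∈ Finset.range (m + 1), ∫⁻ ω in B i, ENNReal.ofReal (V ω) ∂P := by
        rw [hunion, lintegral_biUnion_finset hdisj fun i _ => hBm i]
    _ ≤ ∑ i ∈ Finset.range (m + 1), ∫⁻ ω in B i, ENNReal.ofReal (N ω) ∂P :=
        Finset.sum_le_sum hcell
    _ = ∫⁻ ω in ⋃ i ∈ Finset.range (m + 1), B i, ENNReal.ofReal (N ω) ∂P :=
        (lintegral_biUnion_finset hdisj (fun i _ => hBm i) _).symm
    _ ≤ ∫⁻ ω, ENNReal.ofReal (N ω) ∂P := setLIntegral_le_lintegral _ _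
    _ = ENNReal.ofReal (∫ ω, N ω ∂P) := (ofReal_integral_eq_lintegral_ofReal hN hN_nonneg).symm

lemma measure_le_rpow_lintegral_exp_mul {a : Ω → ℝ} (ha : AEMeasurable a P) {p : ℝ} (hp0 : 0 < p)
    (hp1 : p < 1) (U : Set Ω) :
    P U ≤ (∫⁻ ω, ENNReal.ofReal (Real.exp (p * a ω / (1 - p))) ∂P) ^ (1 - p) *
      (∫⁻ ω in U, ENNReal.ofReal (Real.exp (-a ω)) ∂P) ^ p := by
  have hp1' : 0 < 1 - p := sub_pos.2 hp1
  have hconj : (1 - p)⁻¹.HolderConjugate p⁻¹ :=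
    Real.holderConjugate_iff.2 ⟨(one_lt_inv₀ hp1').2 (by linarith), by simp⟩
  have hprod : ∀ ω, (1 : ℝ≥0∞) =
      ENNReal.ofReal (Real.exp (p * a ω)) * ENNReal.ofReal (Real.exp (-(p * a ω))) := fun ω => by
    rw [← ENNReal.ofReal_mul (Real.exp_pos _).le, ← Real.exp_add, add_neg_cancel, Real.exp_zero,
      ENNReal.ofReal_one]
  have hpow : ∀ b z : ℝ, 0 < b →
      ENNReal.ofReal (Real.exp z) ^ b⁻¹ = ENNReal.ofReal (Real.exp (z / b)) := fun b z hb => by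
    rw [ENNReal.ofReal_rpow_of_nonneg (Real.exp_pos _).le (inv_pos.2 hb).le, ← Real.exp_mul,
      div_eq_mul_inv]
  have hcancel : ∀ ω, -(p * a ω) / p = -a ω := fun ω => by field_simp
  calc P U = ∫⁻ ω in U, ENNReal.ofReal (Real.exp (p * a ω)) *
        ENNReal.ofReal (Real.exp (-(p * a ω))) ∂P := by
        simp only [← hprod, setLIntegral_one]
    _ ≤ (∫⁻ ω in U, ENNReal.ofReal (Real.exp (p * a ω)) ^ (1 - p)⁻¹ ∂P) ^ (1 / (1 - p)⁻¹) *
        (∫⁻ ω in U, ENNReal.ofReal (Real.exp (-(p * a ω))) ^ p⁻¹ ∂P) ^ (1 / p⁻¹) :=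
        ENNReal.lintegral_mul_le_Lp_mul_Lq _ hconj
          (ha.restrict.const_mul p).exp.ennreal_ofReal
          (ha.restrict.const_mul p).neg.exp.ennreal_ofReal
    _ ≤ (∫⁻ ω, ENNReal.ofReal (Real.exp (p * a ω / (1 - p))) ∂P) ^ (1 - p) *
        (∫⁻ ω in U, ENNReal.ofReal (Real.exp (-a ω)) ∂P) ^ p := by
        simp only [hpow _ _ hp0, hpow _ _ hp1', hcancel, one_div, inv_inv]
        gcongr
        exact Measure.restrict_le_self

end Maximal

/-! ### From a weak-type bound to moments -/

section LayerCake

variable {c p q : ℝ}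

lemma lintegral_Ioc_zero_rpow (hc : 0 ≤ c) (hq : 0 < q) :
    ∫⁻ x in Ioc 0 c, ENNReal.ofReal (x ^ (q - 1)) = ENNReal.ofReal (c ^ q / q) := by
  have hint : IntervalIntegrable (fun x : ℝ => x ^ (q - 1)) volume 0 c :=
    intervalIntegral.intervalIntegrable_rpow' (by linarith)
  have hnonneg : ∀ᵐ x ∂volume.restrict (Ioc 0 c), 0 ≤ x ^ (q - 1) := by
    filter_upwards [ae_restrict_mem measurableSet_Ioc] with x hx using Real.rpow_nonneg hx.1.le _
  rw [← ofReal_integral_eq_lintegral_ofReal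
      ((intervalIntegrable_iff_integrableOn_Ioc_of_le hc).1 hint) hnonneg,
    ← intervalIntegral.integral_of_le hc, integral_rpow (Or.inl (by linarith)), sub_add_cancel,
    Real.zero_rpow hq.ne', sub_zero]

lemma lintegral_Ioi_rpow_neg (hc : 0 < c) (hq : 0 < q) :
    ∫⁻ x in Ioi c, ENNReal.ofReal (x ^ (-q - 1)) = ENNReal.ofReal (c ^ (-q) / q) := by
  have hnonneg : ∀ᵐ x ∂volume.restrict (Ioi c), 0 ≤ x ^ (-q - 1) := by
    filter_upwards [ae_restrict_mem measurableSet_Ioi] with x hx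
      using Real.rpow_nonneg (hc.trans hx).le _
  rw [← ofReal_integral_eq_lintegral_ofReal (integrableOn_Ioi_rpow_of_lt (by linarith) hc) hnonneg,
    integral_Ioi_rpow_of_lt (by linarith) hc, sub_add_cancel, neg_div_neg_eq]

lemma lintegral_Ioi_rpow_mul_rpow (hc : 0 ≤ c) (hq : 0 < q) (hqp : q < p) :
    ∫⁻ x in Ioi c, ENNReal.ofReal ((c / x) ^ p) * ENNReal.ofReal (x ^ (q - 1)) =
      ENNReal.ofReal (c ^ q / (p - q)) := by
  have hfactor : EqOn
      (fun x => ENNReal.ofReal ((c / x) ^ p) * ENNReal.ofReal (x ^ (q - 1)))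
      (fun x => ENNReal.ofReal (c ^ p) * ENNReal.ofReal (x ^ (-(p - q) - 1))) (Ioi c) := by
    intro x hx
    have hx0 : 0 < x := hc.trans_lt hx
    have hexp : x ^ (-(p - q) - 1) = (x ^ p)⁻¹ * x ^ (q - 1) := by
      rw [← Real.rpow_neg hx0.le, ← Real.rpow_add hx0]
      ring_nf
    simp only [hexp, Real.div_rpow hc hx0.le]
    rw [← ENNReal.ofReal_mul (by positivity), ← ENNReal.ofReal_mul (by positivity)]
    ring_nf
  rw [setLIntegral_congr_fun measurableSet_Ioi hfactor,
    lintegral_const_mul' _ _ ENNReal.ofReal_ne_top]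
  rcases hc.eq_or_lt with rfl | hc
  · simp [Real.zero_rpow hq.ne', Real.zero_rpow (hq.trans hqp).ne']
  · have hpow : c ^ q = c ^ p * c ^ (-(p - q)) := by rw [← Real.rpow_add hc]; ring_nf
    rw [lintegral_Ioi_rpow_neg hc (sub_pos.2 hqp), ← ENNReal.ofReal_mul (by positivity), hpow,
      mul_div_assoc]

variable {Ω : Type*} {mΩ : MeasurableSpace Ω} {P : Measure Ω} [IsZeroOrProbabilityMeasure P]
  {X : Ω → ℝ}

/-- Levels below `c` are charged at most `1`, levels above `c` at most the assumed bound. -/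
lemma lintegral_rpow_le_of_measure_lt_le (hX : AEMeasurable X P) (hX_nonneg : 0 ≤ᵐ[P] X)
    (hc : 0 ≤ c) (hq : 0 < q) (hqp : q < p)
    (htail : ∀ x, 0 < x → P {ω | x < X ω} ≤ ENNReal.ofReal ((c / x) ^ p)) :
    ∫⁻ ω, ENNReal.ofReal (X ω ^ q) ∂P ≤ ENNReal.ofReal (p / (p - q) * c ^ q) := by
  have hpq : 0 < p - q := sub_pos.2 hqp
  have hlow : ∫⁻ x in Ioc 0 c, P {ω | x < X ω} * ENNReal.ofReal (x ^ (q - 1)) ≤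
      ENNReal.ofReal (c ^ q / q) := by
    rw [← lintegral_Ioc_zero_rpow hc hq]
    exact lintegral_mono fun x => mul_le_of_le_one_left zero_le prob_le_one
  have hhigh : ∫⁻ x in Ioi c, P {ω | x < X ω} * ENNReal.ofReal (x ^ (q - 1)) ≤
      ENNReal.ofReal (c ^ q / (p - q)) := by
    rw [← lintegral_Ioi_rpow_mul_rpow hc hq hqp]
    refine setLIntegral_mono' measurableSet_Ioi fun x hx => ?_
    gcongr
    exact htail x (hc.trans_lt hx)
  rw [lintegral_rpow_eq_lintegral_meas_lt_mul P hX_nonneg hX hq, ← Ioc_union_Ioi_eq_Ioi hc,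
    lintegral_union measurableSet_Ioi (Ioc_disjoint_Ioi le_rfl)]
  calc ENNReal.ofReal q * _
      ≤ ENNReal.ofReal q * (ENNReal.ofReal (c ^ q / q) + ENNReal.ofReal (c ^ q / (p - q))) := by
        gcongr
    _ = ENNReal.ofReal (p / (p - q) * c ^ q) := by
        rw [← ENNReal.ofReal_add (by positivity) (by positivity), ← ENNReal.ofReal_mul hq.le]
        congr 1
        field_simp
        ring

lemma lintegral_rpow_le_of_rpow_mul_measure_lt_le (hX : AEMeasurable X P) (hX_nonneg : 0 ≤ᵐ[P] X)
    (hq : 0 < q) (hqp : q < p) {D : ℝ≥0∞}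
    (htail : ∀ x, 0 < x → ENNReal.ofReal x ^ p * P {ω | x < X ω} ≤ D) :
    ∫⁻ ω, ENNReal.ofReal (X ω ^ q) ∂P ≤ ENNReal.ofReal (p / (p - q)) * D ^ (q / p) := by
  have hp : 0 < p := hq.trans hqp
  have hC : 0 < p / (p - q) := div_pos hp (sub_pos.2 hqp)
  rcases eq_or_ne D ∞ with rfl | hD
  · rw [ENNReal.top_rpow_of_pos (div_pos hq hp), ENNReal.mul_top (ENNReal.ofReal_pos.2 hC).ne']
    exact le_top
  refine (lintegral_rpow_le_of_measure_lt_le (c := D.toReal ^ p⁻¹) hX hX_nonneg (by positivity)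
    hq hqp fun x hx => ?_).trans_eq ?_
  · rw [Real.div_rpow (by positivity) hx.le, Real.rpow_inv_rpow ENNReal.toReal_nonneg hp.ne',
      ENNReal.ofReal_div_of_pos (by positivity), ENNReal.ofReal_toReal hD,
      ← ENNReal.ofReal_rpow_of_pos hx, ENNReal.le_div_iff_mul_le (by simp [hx]) (by simp [hx]),
      mul_comm]
    exact htail x hx
  · rw [ENNReal.ofReal_mul hC.le, ← Real.rpow_mul ENNReal.toReal_nonneg, inv_mul_eq_div,
      ← ENNReal.ofReal_rpow_of_nonneg ENNReal.toReal_nonneg (by positivity),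
      ENNReal.ofReal_toReal hD]

end LayerCake

/-! ### Stopped paths and exceptional times -/

section Path

lemma le_of_dense_of_continuousWithinAt_Ici {α β : Type*} [LinearOrder α] [TopologicalSpace α]
    [OrderTopology α] [DenselyOrdered α] [Preorder β] [TopologicalSpace β]
    [OrderClosedTopology β] {f g : α → β} {D : Set α} {u t : α} (hD : Dense D)
    (hf : ContinuousWithinAt f (Ici u) u) (hg : ContinuousWithinAt g (Ici u) u)
    (hfg : ∀ v ∈ D, v < t → f v ≤ g v) (hu : u < t) : f u ≤ g u := by
  have hmem : u ∈ closure (Ioo u t ∩ D) := by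
    refine closure_mono (hD.open_subset_closure_inter isOpen_Ioo) |>.trans closure_closure.subset ?_
    rw [closure_Ioo hu.ne]
    exact left_mem_Icc.2 hu.le
  have hsub : Ioo u t ∩ D ⊆ Ici u := fun v hv => hv.1.1.le
  exact ContinuousWithinAt.closure_le hmem (hf.mono hsub) (hg.mono hsub)
    fun v hv => hfg v hv.2 hv.1.2

lemma continuousWithinAt_setIntegral_Ioc {μ : Measure ℝ≥0} {g : ℝ≥0 → ℝ} {x : ℝ≥0}
    (hg : ∀ y, IntegrableOn g (Ioc x y) μ) (u : ℝ≥0) :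
    ContinuousWithinAt (fun v => ∫ r in Ioc x v, g r ∂μ) (Ici u) u := by
  simp only [← integral_indicator measurableSet_Ioc]
  refine continuousWithinAt_of_dominated (bound := (Ioc x (u + 1)).indicator fun r => ‖g r‖)
    (Eventually.of_forall fun v => ((hg v).integrable_indicator measurableSet_Ioc).1) ?_
    (IntegrableOn.integrable_indicator (hg (u + 1)).norm measurableSet_Ioc)
    (ae_of_all _ fun r => ?_)
  · filter_upwards [nhdsWithin_le_nhds (Iic_mem_nhds (lt_add_one u))] with v hv
    refine ae_of_all _ fun r => ?_
    rw [norm_indicator_eq_indicator_norm]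
    exact indicator_le_indicator_of_subset (Ioc_subset_Ioc_right hv) (fun _ => norm_nonneg _) r
  · refine continuousWithinAt_const.congr_of_eventuallyEq (f := fun _ => (Ioc x u).indicator g r)
      ?_ rfl
    rcases le_or_gt r u with hru | hur
    · filter_upwards [self_mem_nhdsWithin] with v hv
      simp only [indicator_apply, mem_Ioc, hru, hru.trans hv]
    · filter_upwards [nhdsWithin_le_nhds (Iio_mem_nhds hur)] with v hv
      simp only [indicator_apply, mem_Ioc, hur.not_ge, (mem_Iio.1 hv).not_ge]

variable {a f ξ : ℝ≥0 → ℝ} {σ : WithTop ℝ≥0} {s t u v : ℝ≥0} {h : ℝ}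

lemma le_toReal_add_of_coe_le {k : ℝ≥0∞} {m : ℝ} (hc : Continuous a) (hm : Monotone a)
    (hξ : IsCadlag ξ) (hξ_nonneg : ∀ u, 0 ≤ ξ u) (hk : k ≠ ∞)
    (hle : (ξ s : EReal) ≤ (k : EReal) +
      (∫⁻ r in Icc 0 s, ENNReal.ofReal (ξ r) ∂pathMeasure a : ℝ≥0∞) + m) :
    ξ s ≤ k.toReal + (∫ r in Ioc 0 s, ξ r ∂pathMeasure a) + m := by
  have := nullSingletonClass_pathMeasure hc hm
  rw [← setLIntegral_congr Ioc_ae_eq_Icc, ← ofReal_integral_eq_lintegral_ofReal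
    (hξ.integrableOn 0 s) (ae_of_all _ hξ_nonneg), EReal.coe_ennreal_ofReal,
    max_eq_left (integral_nonneg hξ_nonneg), ← EReal.coe_ennreal_toReal hk] at hle
  exact_mod_cast hle

lemma le_add_setIntegral_of_dense {D : Set ℝ≥0} (hD : Dense D) (hξ : IsCadlag ξ) (hf : IsCadlag f)
    (ht : ξ t ≤ h + (∫ r in Ioc 0 t, ξ r ∂pathMeasure a) + f t)
    (hle : ∀ u ∈ D, u < t → ξ u ≤ h + (∫ r in Ioc 0 u, ξ r ∂pathMeasure a) + f u)
    (hu : u ≤ t) : ξ u ≤ h + (∫ r in Ioc 0 u, ξ r ∂pathMeasure a) + f u := by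
  rcases hu.eq_or_lt with rfl | hut
  · exact ht
  · have hint := continuousWithinAt_setIntegral_Ioc (hξ.integrableOn (μ := pathMeasure a) 0) u
    exact le_of_dense_of_continuousWithinAt_Ici hD (hξ.1 u)
      ((continuousWithinAt_const.add hint).add (hf.1 u)) hle hut

/-- The path `f` stopped at the possibly infinite time `σ`. -/
noncomputable def stopPath (f : ℝ≥0 → ℝ) (σ : WithTop ℝ≥0) (v : ℝ≥0) : ℝ :=
  f (min (v : WithTop ℝ≥0) σ).untopA

lemma stopPath_of_le (hv : (v : WithTop ℝ≥0) ≤ σ) : stopPath f σ v = f v := by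
  rw [stopPath, min_eq_left hv]; rfl

lemma stopPath_coe (f : ℝ≥0 → ℝ) (c : ℝ≥0) : stopPath f c = fun v => f (min v c) :=
  funext fun v => by rw [stopPath, ← WithTop.coe_min]; rfl

lemma exists_stopPath_eq (f : ℝ≥0 → ℝ) (σ : WithTop ℝ≥0) (s : ℝ≥0) :
    ∃ u ≤ s, stopPath f σ s = f u := by
  cases σ with
  | top => exact ⟨s, le_rfl, stopPath_of_le le_top⟩
  | coe c => exact ⟨min s c, min_le_left s c, by rw [stopPath_coe]⟩

lemma isCadlag_stopPath (hf : IsCadlag f) (σ : WithTop ℝ≥0) : IsCadlag (stopPath f σ) := by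
  cases σ with
  | top => rwa [show stopPath f ⊤ = f from funext fun _ => stopPath_of_le le_top]
  | coe c =>
    rw [stopPath_coe]
    have hmin : Continuous fun v : ℝ≥0 => min v c := by fun_prop
    refine ⟨fun u => (hf.1 (min u c)).comp (f := fun v => min v c) hmin.continuousWithinAt
      fun v hv => min_le_min_right c hv, fun u => ?_⟩
    rcases le_or_gt u c with huc | hcu
    · obtain ⟨l, hl⟩ := hf.2 u
      refine ⟨l, hl.congr' ?_⟩
      filter_upwards [self_mem_nhdsWithin] with v hv
      rw [min_eq_left ((mem_Iio.1 hv).le.trans huc)]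
    · refine ⟨f c, tendsto_const_nhds.congr' ?_⟩
      filter_upwards [nhdsWithin_le_nhds (Ioi_mem_nhds hcu)] with v hv
      rw [min_eq_right (mem_Ioi.1 hv).le]

lemma discount_stopPath (hc : Continuous a) (hm : Monotone a) (hf : IsCadlag f)
    (σ : WithTop ℝ≥0) (s : ℝ≥0) :
    discount a (stopPath f σ) s = stopPath (discount a f) σ s := by
  rcases le_or_gt (s : WithTop ℝ≥0) σ with hsσ | hσs
  · rw [stopPath_of_le hsσ]
    exact discount_congr fun u hu => stopPath_of_le ((WithTop.coe_le_coe.2 hu).trans hsσ)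
  · lift σ to ℝ≥0 using hσs.ne_top with c
    have hcs : c ≤ s := WithTop.coe_le_coe.1 hσs.le
    have hint := (isCadlag_stopPath hf c).integrableOn (μ := pathMeasure a) 0 s
    rw [stopPath_coe] at hint ⊢
    rw [discount_min hc hm hcs hint, stopPath_coe]
    simp only [min_eq_right hcs]

lemma mul_exp_neg_le_discount_stopPath (hc : Continuous a) (hm : Monotone a) (ha : a 0 = 0)
    (hξ : IsCadlag ξ) (hξ_nonneg : ∀ u, 0 ≤ ξ u) (hf : IsCadlag f)
    (hle : ∀ u ≤ s, ξ u ≤ h + (∫ r in Ioc 0 u, ξ r ∂pathMeasure a) + f u)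
    (hsσ : (s : WithTop ℝ≥0) ≤ σ) :
    ξ s * Real.exp (-a s) ≤ h + discount a (stopPath f σ) s := by
  simpa [discount_stopPath hc hm hf, stopPath_of_le hsσ, ha] using
    mul_exp_neg_le_of_le_integral hc hm (hξ.integrableOn 0 s) hξ_nonneg (hf.integrableOn 0 s) hle

lemma add_discount_stopPath_nonneg (hc : Continuous a) (hm : Monotone a) (ha : a 0 = 0)
    (hξ : IsCadlag ξ) (hξ_nonneg : ∀ u, 0 ≤ ξ u) (hf : IsCadlag f)
    (hle : ∀ u ≤ t, ξ u ≤ h + (∫ r in Ioc 0 u, ξ r ∂pathMeasure a) + f u)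
    (σ : WithTop ℝ≥0) : 0 ≤ h + discount a (stopPath f σ) t := by
  obtain ⟨s, hst, hs⟩ := exists_stopPath_eq (discount a f) σ t
  have hbound := mul_exp_neg_le_discount_stopPath (σ := ⊤) hc hm ha hξ hξ_nonneg hf
    (fun u hu => hle u (hu.trans hst)) le_top
  rw [discount_stopPath hc hm hf, stopPath_of_le le_top] at hbound
  rw [discount_stopPath hc hm hf, hs]
  exact (mul_nonneg (hξ_nonneg s) (Real.exp_pos _).le).trans hbound

end Path

/-! ### Maxima along grids and the stochastic Gronwall inequality -/

section GridMax

variable {Ω : Type*} {mΩ : MeasurableSpace Ω} {P : Measure Ω} {𝓕 : Filtration ℝ≥0 mΩ}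
  {ξ A M Y : ℝ≥0 → Ω → ℝ} {σ : Ω → WithTop ℝ≥0} {H : Ω → ℝ} {ω : Ω} {t : ℝ≥0} {n i : ℕ}
  {x p q : ℝ}

/-- The maximum of (the positive part of) `ξ` over those points of the `n`-th uniform grid of
`[0, t]` which do not exceed `σ`. -/
noncomputable def gridMax (ξ : ℝ≥0 → Ω → ℝ) (t : ℝ≥0) (σ : Ω → WithTop ℝ≥0) (n : ℕ)
    (ω : Ω) : ℝ≥0 :=
  (Finset.range (n + 1 + 1)).sup fun i =>
    {ω | (gridPoint 0 t n i : WithTop ℝ≥0) ≤ σ ω}.indicator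
      (fun ω => (ξ (gridPoint 0 t n i) ω).toNNReal) ω

lemma measurable_gridMax (hξ : StronglyAdapted 𝓕 ξ) (hσ : IsStoppingTime 𝓕 σ) (t : ℝ≥0) (n : ℕ) :
    Measurable (gridMax ξ t σ n) := by
  have hsup : gridMax ξ t σ n = (Finset.range (n + 1 + 1)).sup fun i =>
      {ω | (gridPoint 0 t n i : WithTop ℝ≥0) ≤ σ ω}.indicator
        fun ω => (ξ (gridPoint 0 t n i) ω).toNNReal :=
    funext fun ω => by rw [gridMax, Finset.sup_apply]
  rw [hsup]
  exact Finset.sup_induction measurable_const (fun _ hf _ hg => hf.sup hg) fun i _ =>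
    ((hξ _).mono (𝓕.le _)).measurable.real_toNNReal.indicator (𝓕.le _ _ (hσ.measurableSet_ge _))

lemma exists_lt_of_lt_gridMax (hx : 0 < x) (hlt : x < gridMax ξ t σ n ω) :
    ∃ i ≤ n + 1, (gridPoint 0 t n i : WithTop ℝ≥0) ≤ σ ω ∧ x < ξ (gridPoint 0 t n i) ω := by
  lift x to ℝ≥0 using hx.le
  obtain ⟨i, hi, hlt⟩ := Finset.lt_sup_iff.1 (NNReal.coe_lt_coe.1 hlt)
  have hσ : ω ∈ {ω | (gridPoint 0 t n i : WithTop ℝ≥0) ≤ σ ω} :=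
    mem_of_indicator_ne_zero hlt.ne_bot
  rw [indicator_of_mem hσ, Real.lt_toNNReal_iff_coe_lt] at hlt
  exact ⟨i, Finset.mem_range_succ_iff.1 hi, hσ, hlt⟩

lemma le_gridMax (hi : i ≤ n + 1) (hσ : (gridPoint 0 t n i : WithTop ℝ≥0) ≤ σ ω) :
    ξ (gridPoint 0 t n i) ω ≤ gridMax ξ t σ n ω := by
  have hmem : ω ∈ {ω | (gridPoint 0 t n i : WithTop ℝ≥0) ≤ σ ω} := hσ
  have hle := Finset.le_sup (f := fun i => {ω | (gridPoint 0 t n i : WithTop ℝ≥0) ≤ σ ω}.indicator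
    (fun ω => (ξ (gridPoint 0 t n i) ω).toNNReal) ω) (Finset.mem_range_succ_iff.2 hi)
  rw [indicator_of_mem hmem] at hle
  exact (Real.le_coe_toNNReal _).trans (NNReal.coe_le_coe.2 hle)

lemma eventually_lt_gridMax {τ : ℕ → Ω → WithTop ℝ≥0} (hξ : IsCadlag fun s => ξ s ω)
    (hτ : Tendsto (τ · ω) atTop (𝓝 ⊤)) {s : ℝ≥0} (hs : s ≤ t) (hx : x < ξ s ω) :
    ∀ᶠ n in atTop, x < gridMax ξ t (τ n) n ω := by
  have hτ_ge : ∀ᶠ n in atTop, (t : WithTop ℝ≥0) ≤ τ n ω :=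
    (hτ.eventually_const_lt (WithTop.coe_lt_top t)).mono fun _ => le_of_lt
  suffices hgrid : ∀ᶠ n in atTop, ∃ i ≤ n + 1, x < ξ (gridPoint 0 t n i) ω by
    filter_upwards [hgrid, hτ_ge] with n ⟨i, hi, hxi⟩ hτn
    exact hxi.trans_le <| le_gridMax hi <|
      (WithTop.coe_le_coe.2 (gridPoint_mem_Icc zero_le hi).2).trans hτn
  rcases eq_zero_or_pos s with rfl | hs0
  · exact Eventually.of_forall fun n => ⟨0, zero_le, by rwa [gridPoint_zero]⟩
  · filter_upwards [(hξ.tendsto_comp_gridCeil ⟨hs0, hs⟩).eventually_const_lt hx] with n hn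
    obtain ⟨i, hi, hceil⟩ := exists_gridCeil_eq_gridPoint ⟨hs0, hs⟩ n
    exact ⟨i, hi, hceil ▸ hn⟩

lemma iSup_rpow_le_liminf_gridMax {τ : ℕ → Ω → WithTop ℝ≥0} (hξ : IsCadlag fun s => ξ s ω)
    (hτ : Tendsto (τ · ω) atTop (𝓝 ⊤)) (t : ℝ≥0) (hq : 0 < q) :
    (⨆ s ∈ Icc 0 t, ENNReal.ofReal (ξ s ω)) ^ q ≤
      liminf (fun n => ENNReal.ofReal ((gridMax ξ t (τ n) n ω : ℝ) ^ q)) atTop := by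
  refine le_of_forall_lt_imp_le_of_dense fun y hy => le_liminf_of_le (by isBoundedDefault) ?_
  rw [← ENNReal.rpow_inv_lt_iff hq] at hy
  obtain ⟨s, hs, hlt⟩ : ∃ s ∈ Icc 0 t, y ^ q⁻¹ < ENNReal.ofReal (ξ s ω) := by
    simpa only [lt_iSup_iff, exists_prop] using hy
  have hy_top : y ^ q⁻¹ ≠ ∞ := (hlt.trans ENNReal.ofReal_lt_top).ne
  filter_upwards [eventually_lt_gridMax hξ hτ hs.2
    ((ENNReal.lt_ofReal_iff_toReal_lt hy_top).1 hlt)] with n hn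
  rw [← ENNReal.ofReal_rpow_of_nonneg (NNReal.coe_nonneg _) hq.le, ← ENNReal.rpow_inv_le_iff hq]
  exact ((ENNReal.lt_ofReal_iff_toReal_lt hy_top).2 hn).le

lemma setLIntegral_lt_gridMax_le [IsFiniteMeasure P] (hA : IsIncreasingProcess A 𝓕 P)
    (hY : Martingale Y 𝓕 P) (hY_cadlag : ∀ᵐ ω ∂P, IsCadlag fun s => Y s ω)
    (hY_zero : ∀ᵐ ω ∂P, Y 0 ω = 0) (hξ : StronglyAdapted 𝓕 ξ) (hσ : IsStoppingTime 𝓕 σ)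
    (hH : Integrable H P)
    (hle : ∀ s ≤ t, ∀ᵐ ω ∂P, (s : WithTop ℝ≥0) ≤ σ ω →
      ξ s ω * Real.exp (-A s ω) ≤ H ω + discount (fun u => A u ω) (fun u => Y u ω) s)
    (hnonneg : ∀ᵐ ω ∂P, 0 ≤ H ω + discount (fun u => A u ω) (fun u => Y u ω) t) (hx : 0 < x)
    (n : ℕ) :
    ∫⁻ ω in {ω | x < gridMax ξ t σ n ω}, ENNReal.ofReal (x * Real.exp (-A t ω)) ∂P ≤
      ENNReal.ofReal (∫ ω, H ω ∂P) := by
  set r := gridPoint 0 t n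
  have hr : ∀ i ≤ n + 1, r i ≤ t := fun i hi => (gridPoint_mem_Icc zero_le hi).2
  set C : ℕ → Set Ω := fun i => {ω | (r i : WithTop ℝ≥0) ≤ σ ω} ∩ {ω | x < ξ (r i) ω}
  have hD := hA.integrable_discount hY hY_cadlag
  have hsub : {ω | x < gridMax ξ t σ n ω} ⊆ ⋃ i ∈ Finset.range (n + 1 + 1), C i := fun ω hω => by
    obtain ⟨i, hi, hσi, hxi⟩ := exists_lt_of_lt_gridMax hx hω
    exact mem_biUnion (Finset.mem_range_succ_iff.2 hi) ⟨hσi, hxi⟩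
  have hC : ∀ i, MeasurableSet[𝓕 (r i)] (C i) := fun i =>
    (hσ.measurableSet_ge (r i)).inter ((hξ (r i)).measurable measurableSet_Ioi)
  refine (lintegral_mono_set hsub).trans <| (setLIntegral_biUnion_le_integral
    (monotone_gridPoint 0 t n) (fun i => hH.add (hD (r i))) (hH.add (hD t)) hnonneg
    (ae_of_all _ fun ω => by positivity) (fun i hi B hB => ?_) hC fun i hi => ?_).trans_eq ?_
  · simp only [Pi.add_apply]
    rw [integral_add hH.integrableOn (hD t).integrableOn,
      integral_add hH.integrableOn (hD (r i)).integrableOn,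
      hA.setIntegral_discount hY hY_cadlag (hr i hi) hB]
  · filter_upwards [hle (r i) (hr i hi), hA.mono] with ω hle hm ⟨hσi, hxi⟩
    refine le_trans ?_ (hle hσi)
    exact mul_le_mul hxi.le (Real.exp_le_exp.2 (neg_le_neg (hm (hr i hi)))) (Real.exp_pos _).le
      (hx.trans hxi).le
  · simp only [Pi.add_apply]
    rw [integral_add hH (hD t), hA.integral_discount_eq_zero hY hY_cadlag hY_zero, add_zero]

lemma rpow_mul_measure_lt_gridMax_le [IsFiniteMeasure P] (hA : IsIncreasingProcess A 𝓕 P)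
    (hY : Martingale Y 𝓕 P) (hY_cadlag : ∀ᵐ ω ∂P, IsCadlag fun s => Y s ω)
    (hY_zero : ∀ᵐ ω ∂P, Y 0 ω = 0) (hξ : StronglyAdapted 𝓕 ξ) (hσ : IsStoppingTime 𝓕 σ)
    (hH : Integrable H P)
    (hle : ∀ s ≤ t, ∀ᵐ ω ∂P, (s : WithTop ℝ≥0) ≤ σ ω →
      ξ s ω * Real.exp (-A s ω) ≤ H ω + discount (fun u => A u ω) (fun u => Y u ω) s)
    (hnonneg : ∀ᵐ ω ∂P, 0 ≤ H ω + discount (fun u => A u ω) (fun u => Y u ω) t)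
    (hp0 : 0 < p) (hp1 : p < 1) (hx : 0 < x) (n : ℕ) :
    ENNReal.ofReal x ^ p * P {ω | x < gridMax ξ t σ n ω} ≤
      (∫⁻ ω, ENNReal.ofReal (Real.exp (p * A t ω / (1 - p))) ∂P) ^ (1 - p) *
        ENNReal.ofReal (∫ ω, H ω ∂P) ^ p := by
  set U := {ω | x < gridMax ξ t σ n ω}
  set K := ∫⁻ ω, ENNReal.ofReal (Real.exp (p * A t ω / (1 - p))) ∂P
  have hAt : AEMeasurable (A t) P := ((hA.adapted t).mono (𝓕.le t)).measurable.aemeasurable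
  calc ENNReal.ofReal x ^ p * P U
      ≤ ENNReal.ofReal x ^ p *
          (K ^ (1 - p) * (∫⁻ ω in U, ENNReal.ofReal (Real.exp (-A t ω)) ∂P) ^ p) := by
        gcongr
        exact measure_le_rpow_lintegral_exp_mul hAt hp0 hp1 U
    _ = K ^ (1 - p) * (∫⁻ ω in U, ENNReal.ofReal (x * Real.exp (-A t ω)) ∂P) ^ p := by
        simp only [ENNReal.ofReal_mul hx.le]
        rw [lintegral_const_mul' _ _ ENNReal.ofReal_ne_top, ENNReal.mul_rpow_of_nonneg _ _ hp0.le,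
          mul_left_comm]
    _ ≤ K ^ (1 - p) * ENNReal.ofReal (∫ ω, H ω ∂P) ^ p := by
        gcongr
        exact setLIntegral_lt_gridMax_le hA hY hY_cadlag hY_zero hξ hσ hH hle hnonneg hx n

lemma ae_stoppedProcess_eq_stopPath (hM_zero : ∀ᵐ ω ∂P, M 0 ω = 0) (σ : Ω → WithTop ℝ≥0) :
    ∀ᵐ ω ∂P, (fun v => stoppedProcess (fun i => {ω | ⊥ < σ ω}.indicator (M i)) σ v ω) =
      stopPath (fun u => M u ω) (σ ω) := by
  filter_upwards [hM_zero] with ω h0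
  by_cases hσ : ⊥ < σ ω
  · have hmem : ω ∈ {ω | ⊥ < σ ω} := hσ
    simp only [stoppedProcess, indicator_of_mem hmem]
    rfl
  · have hbot : σ ω = (0 : ℝ≥0) := not_bot_lt_iff.1 hσ
    have hmem : ω ∉ {ω | ⊥ < σ ω} := hσ
    simp only [stoppedProcess, indicator_of_notMem hmem, hbot, stopPath_coe, min_zero, h0]

lemma lintegral_gridMax_rpow_le [IsProbabilityMeasure P] (hA : IsIncreasingProcess A 𝓕 P)
    (hξ : StronglyAdapted 𝓕 ξ) (hξ_nonneg : ∀ᵐ ω ∂P, ∀ s, 0 ≤ ξ s ω)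
    (hξ_cadlag : ∀ᵐ ω ∂P, IsCadlag fun s => ξ s ω) (hM_cadlag : ∀ᵐ ω ∂P, IsCadlag fun s => M s ω)
    (hM_zero : ∀ᵐ ω ∂P, M 0 ω = 0) (hσ : IsStoppingTime 𝓕 σ)
    (hY : Martingale (stoppedProcess (fun i => {ω | ⊥ < σ ω}.indicator (M i)) σ) 𝓕 P)
    (hH : Integrable H P)
    (hle : ∀ᵐ ω ∂P, ∀ u ≤ t,
      ξ u ω ≤ H ω + (∫ r in Ioc 0 u, ξ r ω ∂pathMeasure fun s => A s ω) + M u ω)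
    (hq : 0 < q) (hqp : q < p) (hp : p < 1) (n : ℕ) :
    ∫⁻ ω, ENNReal.ofReal ((gridMax ξ t σ n ω : ℝ) ^ q) ∂P ≤ ENNReal.ofReal (p / (p - q)) *
      ((∫⁻ ω, ENNReal.ofReal (Real.exp (p * A t ω / (1 - p))) ∂P) ^ (1 - p) *
        ENNReal.ofReal (∫ ω, H ω ∂P) ^ p) ^ (q / p) := by
  have hY_eq := ae_stoppedProcess_eq_stopPath hM_zero σ
  set Y := stoppedProcess (fun i => {ω | ⊥ < σ ω}.indicator (M i)) σ
  have hY_cadlag : ∀ᵐ ω ∂P, IsCadlag fun s => Y s ω := by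
    filter_upwards [hY_eq, hM_cadlag] with ω hY_eq hM using hY_eq ▸ isCadlag_stopPath hM (σ ω)
  have hY_zero : ∀ᵐ ω ∂P, Y 0 ω = 0 := by
    filter_upwards [hY_eq, hM_zero] with ω hY_eq hM
    exact (congrFun hY_eq 0).trans ((stopPath_of_le bot_le).trans hM)
  refine lintegral_rpow_le_of_rpow_mul_measure_lt_le
    (measurable_gridMax hξ hσ t n).coe_nnreal_real.aemeasurable
    (ae_of_all _ fun ω => NNReal.coe_nonneg _) hq hqp fun x hx =>
    rpow_mul_measure_lt_gridMax_le hA hY hY_cadlag hY_zero hξ hσ hH (fun s hs => ?_) ?_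
      (hq.trans hqp) hp hx n
  · filter_upwards [hY_eq, hA.cont, hA.mono, hA.zero, hξ_nonneg, hξ_cadlag, hM_cadlag, hle]
      with ω hY_eq hc hm h0 hnonneg hξ hM hle hsσ
    rw [hY_eq]
    exact mul_exp_neg_le_discount_stopPath hc hm h0 hξ hnonneg hM (fun u hu => hle u (hu.trans hs))
      hsσ
  · filter_upwards [hY_eq, hA.cont, hA.mono, hA.zero, hξ_nonneg, hξ_cadlag, hM_cadlag, hle]
      with ω hY_eq hc hm h0 hnonneg hξ hM hle
    rw [hY_eq]
    exact add_discount_stopPath_nonneg hc hm h0 hξ hnonneg hM hle (σ ω)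

lemma lintegral_iSup_rpow_le [IsProbabilityMeasure P] (hA : IsIncreasingProcess A 𝓕 P)
    (hξ : StronglyAdapted 𝓕 ξ) (hξ_nonneg : ∀ᵐ ω ∂P, ∀ s, 0 ≤ ξ s ω)
    (hξ_cadlag : ∀ᵐ ω ∂P, IsCadlag fun s => ξ s ω) (hM : IsLocalMartingale M 𝓕 P)
    (hM_zero : ∀ᵐ ω ∂P, M 0 ω = 0) (hH : Integrable H P)
    (hle : ∀ᵐ ω ∂P, ∀ u ≤ t,
      ξ u ω ≤ H ω + (∫ r in Ioc 0 u, ξ r ω ∂pathMeasure fun s => A s ω) + M u ω)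
    (hq : 0 < q) (hqp : q < p) (hp : p < 1) :
    ∫⁻ ω, (⨆ s ∈ Icc 0 t, ENNReal.ofReal (ξ s ω)) ^ q ∂P ≤ ENNReal.ofReal (p / (p - q)) *
      ((∫⁻ ω, ENNReal.ofReal (Real.exp (p * A t ω / (1 - p))) ∂P) ^ (1 - p) *
        ENNReal.ofReal (∫ ω, H ω ∂P) ^ p) ^ (q / p) := by
  obtain ⟨τ, hτ, hY⟩ := hM.locally_martingale
  have hmeas : ∀ n, Measurable fun ω => ENNReal.ofReal ((gridMax ξ t (τ n) n ω : ℝ) ^ q) :=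
    fun n => ((measurable_gridMax hξ (hτ.isStoppingTime n) t n).coe_nnreal_real.pow_const
      q).ennreal_ofReal
  calc ∫⁻ ω, (⨆ s ∈ Icc 0 t, ENNReal.ofReal (ξ s ω)) ^ q ∂P
      ≤ ∫⁻ ω, liminf (fun n => ENNReal.ofReal ((gridMax ξ t (τ n) n ω : ℝ) ^ q)) atTop ∂P := by
        refine lintegral_mono_ae ?_
        filter_upwards [hξ_cadlag, hτ.tendsto_top] with ω hξ hτ
          using iSup_rpow_le_liminf_gridMax hξ hτ t hq
    _ ≤ liminf (fun n => ∫⁻ ω, ENNReal.ofReal ((gridMax ξ t (τ n) n ω : ℝ) ^ q) ∂P) atTop :=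
        lintegral_liminf_le hmeas
    _ ≤ ENNReal.ofReal (p / (p - q)) * _ :=
        liminf_le_of_frequently_le' <| Frequently.of_forall fun n =>
          lintegral_gridMax_rpow_le hA hξ hξ_nonneg hξ_cadlag hM.cadlag hM_zero
            (hτ.isStoppingTime n) (hY n) hH hle hq hqp hp n

end GridMax

section Gronwall

variable {Ω : Type*} {mΩ : MeasurableSpace Ω} {P : Measure Ω} {𝓕 : Filtration ℝ≥0 mΩ}
  {ξ A M : ℝ≥0 → Ω → ℝ} {H : Ω → ℝ≥0∞} {t : ℝ≥0} {p q : ℝ}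

lemma ae_forall_le_toReal_add (hA : IsIncreasingProcess A 𝓕 P)
    (hξ_nonneg : ∀ᵐ ω ∂P, ∀ s, 0 ≤ ξ s ω) (hξ_cadlag : ∀ᵐ ω ∂P, IsCadlag fun s => ξ s ω)
    (hM_cadlag : ∀ᵐ ω ∂P, IsCadlag fun s => M s ω) (hH : ∀ᵐ ω ∂P, H ω ≠ ∞)
    (h_le : ∀ s ≤ t, ∀ᵐ ω ∂P, (ξ s ω : EReal) ≤ (H ω : EReal) +
      (∫⁻ r in Icc 0 s, ENNReal.ofReal (ξ r ω) ∂pathMeasure fun r => A r ω : ℝ≥0∞) + M s ω) :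
    ∀ᵐ ω ∂P, ∀ u ≤ t, ξ u ω ≤ (H ω).toReal +
      (∫ r in Ioc 0 u, ξ r ω ∂pathMeasure fun s => A s ω) + M u ω := by
  have hreal : ∀ s ≤ t, ∀ᵐ ω ∂P, ξ s ω ≤ (H ω).toReal +
      (∫ r in Ioc 0 s, ξ r ω ∂pathMeasure fun s => A s ω) + M s ω := fun s hs => by
    filter_upwards [h_le s hs, hA.cont, hA.mono, hξ_cadlag, hξ_nonneg, hH]
      with ω hle hc hm hξ hnonneg hH using le_toReal_add_of_coe_le hc hm hξ hnonneg hH hle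
  have hdense : ∀ᵐ ω ∂P, ∀ k, TopologicalSpace.denseSeq ℝ≥0 k < t → _ :=
    ae_all_iff.2 fun k => eventually_imp_distrib_left.2 fun hk => hreal _ hk.le
  filter_upwards [hdense, hreal t le_rfl, hξ_cadlag, hM_cadlag] with ω hdense ht hξ hM u hu
  exact le_add_setIntegral_of_dense (TopologicalSpace.denseRange_denseSeq ℝ≥0) hξ hM ht
    (forall_mem_range.2 hdense) hu

lemma one_le_lintegral_exp [IsProbabilityMeasure P] (hA : IsIncreasingProcess A 𝓕 P)
    (hp0 : 0 < p) (hp1 : p < 1) (t : ℝ≥0) :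
    1 ≤ ∫⁻ ω, ENNReal.ofReal (Real.exp (p * A t ω / (1 - p))) ∂P := by
  have : 0 < 1 - p := sub_pos.2 hp1
  calc (1 : ℝ≥0∞) = ∫⁻ _, 1 ∂P := by simp
    _ ≤ ∫⁻ ω, ENNReal.ofReal (Real.exp (p * A t ω / (1 - p))) ∂P := by
      refine lintegral_mono_ae ?_
      filter_upwards [hA.nonneg] with ω h
      rw [ENNReal.one_le_ofReal, Real.one_le_exp_iff]
      have := h t
      positivity

lemma mul_rpow_mul_rpow_rpow_one_div {c : ℝ} (hc : 0 ≤ c) (hp : 0 < p) (hq : 0 < q)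
    (K κ : ℝ≥0∞) :
    (ENNReal.ofReal c * (K ^ (1 - p) * κ ^ p) ^ (q / p)) ^ (1 / q) =
      ENNReal.ofReal (c ^ (1 / q)) * K ^ ((1 - p) / p) * κ := by
  have hqp : q / p * (1 / q) = p⁻¹ := by field_simp
  rw [ENNReal.mul_rpow_of_nonneg _ _ (by positivity), ← ENNReal.rpow_mul, hqp,
    ENNReal.mul_rpow_of_nonneg _ _ (by positivity), ENNReal.rpow_rpow_inv hp.ne',
    ← ENNReal.rpow_mul, ← div_eq_mul_inv, ENNReal.ofReal_rpow_of_nonneg hc (by positivity),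
    mul_assoc]

lemma measurable_setLIntegral_comp_toNNReal {η : ℝ≥0 → Ω → ℝ}
    (hη : Measurable fun z : ℝ≥0 × Ω => η z.1 z.2) (I : Set ℝ) :
    Measurable fun ω => ∫⁻ s in I, ENNReal.ofReal (η s.toNNReal ω) := by
  have hη' : Measurable (Function.uncurry fun (ω : Ω) (s : ℝ) =>
      ENNReal.ofReal (η s.toNNReal ω)) := by fun_prop
  exact hη'.lintegral_prod_right

lemma coe_add_setLIntegral_Icc_le (x : ℝ) (g : ℝ → ℝ≥0∞) {r s t : ℝ} (hst : s ≤ t) :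
    (x : EReal) + (∫⁻ u in Icc r s, g u : ℝ≥0∞) ≤
      (ENNReal.ofReal x + ∫⁻ u in Icc r t, g u : ℝ≥0∞) := by
  rw [EReal.coe_ennreal_add, EReal.coe_ennreal_ofReal]
  gcongr
  · exact le_max_left _ _
  · exact EReal.coe_ennreal_le_coe_ennreal_iff.2 (lintegral_mono_set (Icc_subset_Icc_right hst))

end Gronwall

end StochGronwall

open StochGronwall in
theorem mainTheorem11_general {Ω : Type*} {mΩ : MeasurableSpace Ω} (P : Measure Ω)
    [IsProbabilityMeasure P] (𝓕 : Filtration ℝ≥0 mΩ) (ξ A M : ℝ≥0 → Ω → ℝ) (H : Ω → ℝ≥0∞)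
    (hξ_adapted : StronglyAdapted 𝓕 ξ)
    (hξ_nonneg : ∀ᵐ ω ∂P, ∀ s, 0 ≤ ξ s ω)
    (hξ_cadlag : ∀ᵐ ω ∂P, IsCadlag (fun s => ξ s ω))
    (hA : IsIncreasingProcess A 𝓕 P)
    (hM : IsLocalMartingale M 𝓕 P)
    (hM_zero : ∀ᵐ ω ∂P, M 0 ω = 0)
    (hH : AEMeasurable H P) (t : ℝ≥0)
    (h_le : ∀ s ≤ t, ∀ᵐ ω ∂P, (ξ s ω : EReal) ≤ (H ω : EReal) +
      (∫⁻ r in Icc 0 s, ENNReal.ofReal (ξ r ω) ∂pathMeasure fun r => A r ω : ℝ≥0∞) + M s ω)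
    (p q : ℝ) (hq : 0 < q) (hqp : q < p) (hp : p < 1) :
    (∫⁻ ω, (⨆ s ∈ Icc (0 : ℝ≥0) t, ENNReal.ofReal (ξ s ω)) ^ q ∂P) ^ (1 / q) ≤
      ENNReal.ofReal ((p / (p - q)) ^ (1 / q))
        * (∫⁻ ω, ENNReal.ofReal (Real.exp (p * A t ω / (1 - p))) ∂P) ^ ((1 - p) / p)
        * ∫⁻ ω, H ω ∂P := by
  have hp0 : 0 < p := hq.trans hqp
  have hc : 0 < p / (p - q) := div_pos hp0 (sub_pos.2 hqp)
  rcases eq_or_ne (∫⁻ ω, H ω ∂P) ∞ with hH_top | hH_top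
  · have hK := one_le_lintegral_exp hA hp0 hp t
    rw [hH_top, ENNReal.mul_top]
    · exact le_top
    · exact mul_ne_zero (ENNReal.ofReal_pos.2 (by positivity)).ne'
        (ENNReal.rpow_pos_of_nonneg (zero_lt_one.trans_le hK)
          (div_nonneg (sub_nonneg.2 hp.le) hp0.le)).ne'
  · have hH_fin : ∀ᵐ ω ∂P, H ω < ∞ := ae_lt_top' hH hH_top
    have hpath := ae_forall_le_toReal_add hA hξ_nonneg hξ_cadlag hM.cadlag
      (hH_fin.mono fun _ => LT.lt.ne) h_le
    have hmoment := lintegral_iSup_rpow_le hA hξ_adapted hξ_nonneg hξ_cadlag hM hM_zero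
      (integrable_toReal_of_lintegral_ne_top hH hH_top) hpath hq hqp hp
    rw [integral_toReal hH hH_fin, ENNReal.ofReal_toReal hH_top] at hmoment
    rw [← mul_rpow_mul_rpow_rpow_one_div hc.le hp0 hq]
    gcongr

open StochGronwall in
theorem mainTheorem11 {Ω : Type*} {mΩ : MeasurableSpace Ω} (P : Measure Ω)
    [IsProbabilityMeasure P] (𝓕 : Filtration ℝ≥0 mΩ) (h𝓕 : UsualConditions 𝓕 P)
    (ξ η A M : ℝ≥0 → Ω → ℝ)
    (hξ_meas : Measurable (fun z : ℝ≥0 × Ω => ξ z.1 z.2))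
    (hξ_adapted : StronglyAdapted 𝓕 ξ)
    (hξ_nonneg : ∀ᵐ ω ∂P, ∀ t, 0 ≤ ξ t ω)
    (hξ_cadlag : ∀ᵐ ω ∂P, IsCadlag (fun t => ξ t ω))
    (hη_meas : Measurable (fun z : ℝ≥0 × Ω => η z.1 z.2))
    (hη_adapted : StronglyAdapted 𝓕 η)
    (hη_nonneg : ∀ᵐ ω ∂P, ∀ t, 0 ≤ η t ω)
    (hA_adapted : StronglyAdapted 𝓕 A)
    (hA_cont : ∀ᵐ ω ∂P, Continuous (fun t => A t ω))
    (hA_mono : ∀ᵐ ω ∂P, Monotone (fun t => A t ω))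
    (hA_zero : ∀ᵐ ω ∂P, A 0 ω = 0)
    (hM : IsLocalMartingale M 𝓕 P)
    (hM_zero : ∀ᵐ ω ∂P, M 0 ω = 0)
    -- the integrals are `[0, ∞]`-valued, so the inequality is one between extended reals
    (h_le : ∀ t : ℝ≥0, ∀ᵐ ω ∂P,
      (ξ t ω : EReal) ≤ (ξ 0 ω : EReal)
        + ((∫⁻ s in Icc (0 : ℝ) t, ENNReal.ofReal (η s.toNNReal ω) : ℝ≥0∞) : EReal)
        + ((∫⁻ s in Icc 0 t, ENNReal.ofReal (ξ s ω) ∂(pathMeasure (fun r => A r ω)) : ℝ≥0∞) :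
            EReal)
        + (M t ω : EReal))
    (p q : ℝ) (hq : 0 < q) (hqp : q < p) (hp : p < 1) (t : ℝ≥0) :
    (∫⁻ ω, (⨆ s ∈ Icc (0 : ℝ≥0) t, ENNReal.ofReal (ξ s ω)) ^ q ∂P) ^ (1 / q) ≤
      ENNReal.ofReal ((p / (p - q)) ^ (1 / q))
        * (∫⁻ ω, ENNReal.ofReal (Real.exp (p * A t ω / (1 - p))) ∂P) ^ ((1 - p) / p)
        * ∫⁻ ω, (ENNReal.ofReal (ξ 0 ω) + ∫⁻ s in Icc (0 : ℝ) t, ENNReal.ofReal (η s.toNNReal ω)) ∂P := by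
  refine mainTheorem11_general P 𝓕 ξ A M _ hξ_adapted hξ_nonneg hξ_cadlag
    ⟨hA_adapted, hA_cont, hA_mono, hA_zero⟩ hM hM_zero
    (((hξ_adapted 0).mono (𝓕.le 0)).measurable.ennreal_ofReal.add
      (measurable_setLIntegral_comp_toNNReal hη_meas _)).aemeasurable t
    (fun s hs => (h_le s).mono fun ω hle => hle.trans ?_) p q hq hqp hp
  gcongr
  exact coe_add_setLIntegral_Icc_le (ξ 0 ω) _ hs
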